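/- \textbf{Setting.} A bounded-rate multi-mode system (BMS) $\mathcal H=(M,n,\mathcal R)$ consists of a finite nonempty set $M$ of modes and, for each $m\in M$, a nonempty convex polytope $\mathcal R(m)\subseteq\mathbb R^n$ of rates. In each round of the schedulability game the scheduler picks a mode $m$ and a duration $t\ge 0$ depending on the finite run so far, the environment picks $\vec r\in\mathcal R(m)$, and the state moves from $x$ to $x+t\vec r$ along the segment. The scheduler wins from $x_0$ for the safety set $S$ if it has a strategy such that, against every environment strategy, the run never leaves $S$ and its total duration is infinite; then $x_0$ is called \emph{schedulable}. Let $S=\{x: Ax\le b\}\subseteq\mathbb R^n$ be bounded. For a set $I$ of row indices write $x\models F_I$ if exactly the inequalities indexed by $I$ are tight at $x$ and the others are strict. A rate $\vec r$ is \emph{external} for $I$ if for some $x\models F_I$ we have $x+\delta\vec r\notin S$ for all $\delta>0$; a mode is \emph{unusable} for $I$ if it has an external rate. A rate $\vec r$ is \emph{internal} for $I$ if for every $x\models F_I$ there are $\delta>0$ and $J\subsetneq I$ with $x+\varepsilon\vec r\models F_J$ for all $0<\varepsilon\le\delta$. The system $\mathcal H_I$ has the modes that are not unusable for $I$, each with its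 non-internal rates. A system is \emph{safe} if for every choice of a vertex $R(m)$ of each of its rate sets there are weights $t_m\ge 0$ with $\sum_m t_m=1$ and $\sum_m t_mR(m)=0$. A convex polytope $P$ is \emph{$\mathcal H$-closed} if for every vertex $c$ of $P$ there are a mode $m$ and $\tau>0$ with $c+t\vec r\in P$ for all $\vec r\in\mathcal R(m)$ and $t\in[0,\tau]$. \textbf{Algorithm.} List all $I$ for which $F_I$ is satisfied by some state in an order $I_1,\dots,I_\ell$ such that $I_i\subseteq I_j$ implies $i\le j$. Start with empty sets \textsc{Schedulable}, \textsc{UnSchedulable} and treat each $I$ of the list in turn: if some $I'\subseteq I$ is in \textsc{UnSchedulable}, add $I$ to \textsc{UnSchedulable}; otherwise, if some mode of $\mathcal H$ has only internal rates for $I$, add $(I,\bot)$ to \textsc{Schedulable}; otherwise, if $\mathcal H_I$ is safe and $P_I$ is an $\mathcal H_I$-closed polytope, add $(I,P_I)$ to \textsc{Schedulable}; otherwise add $I$ to \textsc{UnSchedulable}. Here $P_I$ is the convex hull of the points $x_I+\frac{\gamma_I}{\sum_i\|\vec r_i\|}\sum_{i}p_i\vec r_i$, $p_i\in\{0,1\}$,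 where $\vec r_1,\dots,\vec r_N$ are the distinct vertices of the rate sets of $\mathcal H_I$ and $x_I\in\mathbb R^n$, $\gamma_I>0$ are arbitrary ($P_I=\{x_I\}$ if all $\vec r_i$ vanish). On input $x_0$ answer Yes iff $x_0\models F_I$ for some $I$ occurring in \textsc{Schedulable}. \textbf{Theorem.} Let $\mathcal H$ be a BMS and $S=\{x:Ax\le b\}$ a convex polytope. \begin{enumerate} \item An admissible list of faces exists and, for every such list and every $x_0\in S$ (on the boundary or not), the algorithm answers Yes if and only if $x_0$ is schedulable. \item From the set \textsc{Schedulable} one obtains a dynamic winning strategy: there is one scheduler strategy, depending only on the current state and always choosing positive durations, that wins from every $x_0$ satisfying $F_I$ for some $I$ occurring in \textsc{Schedulable}. In a state $y\models F_I$ it chooses a mode with only internal rates for $I$ if $(I,\bot)\in\textsc{Schedulable}$; if $(I,P_I)\in\textsc{Schedulable}$ it chooses a mode of $\mathcal H_I$ all of whose rates in $\mathcal H_I$ keep some vertex of $P_I$ inside $P_I$ for a positive time. \item The decision is effective: if $A$, $b$, $x_0\in S$ and finite nonempty sets $V_m$ with $\mathcal R(m)=\operatorname{conv}V_m$ have entries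 in an ordered field $K\subseteq\mathbb R$ (such as $\mathbb Q$ or $\mathbb R$), then the explicit program that runs the above loop with its tests carried out on $A,b,V_m$ by Fourier--Motzkin elimination, using finitely many field operations and comparisons in $K$, answers Yes if and only if $x_0$ is schedulable. \end{enumerate} -/

import Mathlib

open scoped NNReal Matrix

namespace MultiMode

/-! ### Multi-mode systems and the schedulability game -/

/-- States (and rate vectors): points of `ℝⁿ` with the Euclidean norm. -/
abbrev State (n : ℕ) : Type := EuclideanSpace ℝ (Fin n)

/-- The solution set of `A x ≤ b`. -/
def polyhedron {n k : ℕ} (A : Matrix (Fin k) (Fin n) ℝ) (b : Fin k → ℝ) : Set (State n) :=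
  {x | ∀ j, (A *ᵥ x.ofLp) j ≤ b j}

/-- A convex polytope: a bounded solution set of finitely many linear inequalities. -/
def IsConvexPolytope {n : ℕ} (P : Set (State n)) : Prop :=
  Bornology.IsBounded P ∧
    ∃ (k : ℕ) (A : Matrix (Fin k) (Fin n) ℝ) (b : Fin k → ℝ), P = polyhedron A b

/-- A multi-mode system with mode set `M` and `n` variables, given by its rate-set function. -/
abbrev System (M : Type*) (n : ℕ) : Type _ := M → Set (State n)

/-- Bounded-rate multi-mode systems: the rate set of each mode is a (nonempty) convex polytope. -/
def IsBMS {M : Type*} {n : ℕ} (H : System M n) : Prop :=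
  ∀ m, (H m).Nonempty ∧ IsConvexPolytope (H m)

/-- One round of the game: a timed move of the scheduler and the rate picked by the environment. -/
structure Round (M : Type*) (n : ℕ) where
  mode : M
  time : ℝ≥0
  rate : State n

/-- A finite run; its intermediate states are determined by the starting state and the rounds. -/
structure FRun (M : Type*) (n : ℕ) where
  start : State n
  rounds : List (Round M n)

/-- The last state of a finite run. -/
def FRun.last {M : Type*} {n : ℕ} (h : FRun M n) : State n :=
  h.start + (h.rounds.map fun s => s.time • s.rate).sum

/-- An infinite run. -/
structure Run (M : Type*) (n : ℕ) where
  start : State n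
  round : ℕ → Round M n

/-- The state of an infinite run after `i` rounds. -/
def Run.state {M : Type*} {n : ℕ} (ρ : Run M n) (i : ℕ) : State n :=
  ρ.start + ∑ l ∈ Finset.range i, (ρ.round l).time • (ρ.round l).rate

def Run.IsSafe {M : Type*} {n : ℕ} (S : Set (State n)) (ρ : Run M n) : Prop :=
  ∀ i, ρ.state i ∈ S ∧
    ∀ t : ℝ≥0, t ≤ (ρ.round i).time → ρ.state i + t • (ρ.round i).rate ∈ S

/-- A run is Zeno if its total time is finite. -/
def Run.IsZeno {M : Type*} {n : ℕ} (ρ : Run M n) : Prop :=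
  Summable fun i => (ρ.round i).time

/-- A scheduler strategy gives a timed move for every history. -/
abbrev Scheduler (M : Type*) (n : ℕ) : Type _ := FRun M n → M × ℝ≥0

/-- A strategy is positional if it acts equally on histories with the same last state. -/
def Scheduler.IsPositional {M : Type*} {n : ℕ} (σ : Scheduler M n) : Prop :=
  ∀ h h' : FRun M n, h.last = h'.last → σ h = σ h'

/-- An environment strategy answers a history and a timed move by an allowed rate. -/
structure Environment {M : Type*} {n : ℕ} (H : System M n) where
  pick : FRun M n → M × ℝ≥0 → State n
  pick_mem : ∀ h a, pick h a ∈ H a.1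

section Play

variable {M : Type*} {n : ℕ} {H : System M n}

/-- The round played after the history `h`. -/
def nextRound (σ : Scheduler M n) (π : Environment H) (h : FRun M n) : Round M n :=
  ⟨(σ h).1, (σ h).2, π.pick h (σ h)⟩

/-- The finite run after `i` rounds. -/
def history (x₀ : State n) (σ : Scheduler M n) (π : Environment H) : ℕ → FRun M n
  | 0 => ⟨x₀, []⟩
  | i + 1 =>
    ⟨x₀, (history x₀ σ π i).rounds ++ [nextRound σ π (history x₀ σ π i)]⟩

/-- The run determined by a starting state and a pair of strategies. -/
def play (x₀ : State n) (σ : Scheduler M n) (π : Environment H) : Run M n :=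
  ⟨x₀, fun i => nextRound σ π (history x₀ σ π i)⟩

end Play

/-- `σ` wins: against every environment strategy the run is `S`-safe and non-Zeno. -/
def IsWinning {M : Type*} {n : ℕ} (H : System M n) (S : Set (State n)) (x₀ : State n)
    (σ : Scheduler M n) : Prop :=
  ∀ π : Environment H, (play x₀ σ π).IsSafe S ∧ ¬ (play x₀ σ π).IsZeno

def Schedulable {M : Type*} {n : ℕ} (H : System M n) (S : Set (State n)) (x₀ : State n) : Prop :=
  ∃ σ : Scheduler M n, IsWinning H S x₀ σ

/-! ### Safe systems and closed polytopes -/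

/-- A system is safe if every choice of one extreme rate (vertex) per mode admits weights
`t ≥ 0` of sum `1` under which the chosen rates average to `0`. -/
def IsSafeSystem {M : Type*} [Fintype M] {n : ℕ} (H : System M n) : Prop :=
  ∀ R : M → State n, (∀ m, R m ∈ (H m).extremePoints ℝ) →
    ∃ t : M → ℝ≥0, ∑ m, t m • R m = 0 ∧ ∑ m, t m = 1

/-- Mode `m` keeps the vertex `c` in `P` for a positive time, whatever the rate. -/
def Keeps {M : Type*} {n : ℕ} (H : System M n) (P : Set (State n)) (c : State n) (m : M) : Prop :=
  ∃ τ : ℝ, 0 < τ ∧ ∀ r ∈ H m, ∀ t : ℝ, 0 ≤ t → t ≤ τ → c + t • r ∈ P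

/-- `P` is an `H`-closed convex polytope. -/
def IsHClosed {M : Type*} {n : ℕ} (H : System M n) (P : Set (State n)) : Prop :=
  IsConvexPolytope P ∧ ∀ c ∈ P.extremePoints ℝ, ∃ m, Keeps H P c m

/-- The candidate closed polytope around `x` of radius `γ`: with `r₁, …, r_N` the extreme rates,
the convex hull of the points `x + γ / (∑ ‖rᵢ‖) • ∑ pᵢ • rᵢ`, `pᵢ ∈ {0, 1}`
(the point `x` alone if all extreme rates vanish). -/
noncomputable def candidate {M : Type*} {n : ℕ} (H : System M n) (x : State n) (γ : ℝ) :
    Set (State n) :=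
  convexHull ℝ {y | ∃ F : Finset (State n), (F : Set (State n)) ⊆ ⋃ m, (H m).extremePoints ℝ ∧
    y = x + (γ / ∑ᶠ r ∈ ⋃ m, (H m).extremePoints ℝ, ‖r‖) • ∑ r ∈ F, r}

/-! ### Faces -/

section Faces

variable {M : Type*} {n k : ℕ} (A : Matrix (Fin k) (Fin n) ℝ) (b : Fin k → ℝ) (H : System M n)

/-- `x` satisfies the (open) face `I`: exactly the inequalities indexed by `I` are tight. -/
def OnFace (I : Finset (Fin k)) (x : State n) : Prop :=
  ∀ j, (j ∈ I → (A *ᵥ x.ofLp) j = b j) ∧ (j ∉ I → (A *ᵥ x.ofLp) j < b j)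

/-- `r` is external for `I`: from some point of the face it leaves the polytope at once. -/
def IsExternal (I : Finset (Fin k)) (r : State n) : Prop :=
  ∃ x, OnFace A b I x ∧ ∀ δ : ℝ, 0 < δ → x + δ • r ∉ polyhedron A b

/-- `r` is internal for `I`: from every point of the face it leads at once into a face
given by a proper subset of `I`. -/
def IsInternal (I : Finset (Fin k)) (r : State n) : Prop :=
  ∀ x, OnFace A b I x → ∃ δ : ℝ, 0 < δ ∧ ∃ J, J ⊂ I ∧
    ∀ ε : ℝ, 0 < ε → ε ≤ δ → OnFace A b J (x + ε • r)

/-- A mode is unusable for `I` if it has an external rate. -/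
def Unusable (I : Finset (Fin k)) (m : M) : Prop :=
  ∃ r ∈ H m, IsExternal A b I r

/-- Mode `m` has only internal rates for `I`. -/
def OnlyInternal (I : Finset (Fin k)) (m : M) : Prop :=
  ∀ r ∈ H m, IsInternal A b I r

/-- The restricted system `H_I`: the modes that are not unusable, with the non-internal rates. -/
def restricted (I : Finset (Fin k)) : System {m : M // ¬ Unusable A b H I m} n :=
  fun m => {r ∈ H m | ¬ IsInternal A b I r}

/-- `L` lists the faces satisfied by some state, compatibly with inclusion. -/
def IsFaceSequence (L : List (Finset (Fin k))) : Prop :=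
  L.Nodup ∧ (∀ I, I ∈ L ↔ ∃ x, OnFace A b I x) ∧ L.Pairwise fun I J => ¬ J ⊆ I

end Faces

/-! ### The face-lattice algorithm -/

/-- The sets maintained by the algorithm: schedulable faces (with a polytope, or with `none`
for `⊥`) and unschedulable faces. -/
structure Marks (k : ℕ) (α : Type*) where
  sched : List (Finset (Fin k) × Option α)
  unsched : List (Finset (Fin k))

/-- The loop body. `onlyInternal I`: some mode has only internal rates for `I`;
`closed I`: the closed polytope for `H_I`, or `none` if the test for it fails. -/
def markFace {k : ℕ} {α : Type*} (onlyInternal : Finset (Fin k) → Bool)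
    (closed : Finset (Fin k) → Option α) (s : Marks k α) (I : Finset (Fin k)) : Marks k α :=
  if ∃ J ∈ s.unsched, J ⊆ I then ⟨s.sched, I :: s.unsched⟩
  else if onlyInternal I then ⟨(I, none) :: s.sched, s.unsched⟩
  else match closed I with
    | some P => ⟨(I, some P) :: s.sched, s.unsched⟩
    | none => ⟨s.sched, I :: s.unsched⟩

/-- The loop over the sequence `L` of faces. -/
def markFaces {k : ℕ} {α : Type*} (onlyInternal : Finset (Fin k) → Bool)
    (closed : Finset (Fin k) → Option α) (L : List (Finset (Fin k))) : Marks k α :=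
  L.foldl (markFace onlyInternal closed) ⟨[], []⟩

/-- The returned answer; `onFace I` tests whether the starting state satisfies the face `I`. -/
def Marks.answer {k : ℕ} {α : Type*} (s : Marks k α) (onFace : Finset (Fin k) → Bool) : Bool :=
  s.sched.any fun p => onFace p.1

section Algorithm

variable {M : Type*} [Fintype M] {n k : ℕ} (A : Matrix (Fin k) (Fin n) ℝ) (b : Fin k → ℝ)
  (H : System M n)

open scoped Classical in
/-- The polytope `P_I`, constructed around the point `x` with radius `γ`, if `H_I` is safe and
`P_I` is `H_I`-closed. -/
noncomputable def closedFor (x : State n) (γ : ℝ) (I : Finset (Fin k)) : Option (Set (State n)) :=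
  if IsSafeSystem (restricted A b H I) ∧
      IsHClosed (restricted A b H I) (candidate (restricted A b H I) x γ) then
    some (candidate (restricted A b H I) x γ)
  else none

open scoped Classical in
/-- The sets computed by the algorithm, for the sequence `L` of faces; the polytope for `I` is
built around the point `x I` with radius `γ I`. -/
noncomputable def algorithmMarks (x : Finset (Fin k) → State n) (γ : Finset (Fin k) → ℝ)
    (L : List (Finset (Fin k))) : Marks k (Set (State n)) :=
  markFaces (fun I => decide (∃ m, OnlyInternal A b H I m))
    (fun I => closedFor A b H (x I) (γ I) I) L

open scoped Classical in
/-- The answer of the algorithm for the starting state `x₀`. -/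
noncomputable def algorithm (x : Finset (Fin k) → State n) (γ : Finset (Fin k) → ℝ)
    (L : List (Finset (Fin k))) (x₀ : State n) : Bool :=
  (algorithmMarks A b H x γ L).answer fun I => decide (OnFace A b I x₀)

end Algorithm

/-! ### The algorithm as a program

The same loop, run on finite data over an ordered field with exact arithmetic and comparisons:
the rate polytope of mode `m` is given by a finite set `V m` that spans it, and every test is
carried out by finitely many field operations and comparisons. -/

namespace Program

variable {K : Type*} [Field K] [LinearOrder K]

/-- A linear constraint `∑ aᵢ xᵢ < c` (if `strict`) or `∑ aᵢ xᵢ ≤ c`. -/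
structure Constraint (K : Type*) (d : ℕ) where
  a : Fin d → K
  c : K
  strict : Bool

/-- Elimination of the variable `0` from a list of constraints. -/
def eliminate {d : ℕ} (C : List (Constraint K (d + 1))) : List (Constraint K d) :=
  (C.filter fun p => p.a 0 = 0).map (fun p => ⟨fun i => p.a i.succ, p.c, p.strict⟩) ++
  (C.filter fun p => 0 < p.a 0).flatMap fun p =>
    (C.filter fun q => q.a 0 < 0).map fun q =>
      ⟨fun i => p.a 0 * q.a i.succ - q.a 0 * p.a i.succ, p.a 0 * q.c - q.a 0 * p.c,
        p.strict || q.strict⟩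

/-- Solvability of a list of linear constraints. -/
def feasible : (d : ℕ) → List (Constraint K d) → Bool
  | 0, C => C.all fun p => if p.strict then decide (0 < p.c) else decide (0 ≤ p.c)
  | d + 1, C => feasible d (eliminate C)

def le {d : ℕ} (a : Fin d → K) (c : K) : Constraint K d := ⟨a, c, false⟩

def lt {d : ℕ} (a : Fin d → K) (c : K) : Constraint K d := ⟨a, c, true⟩

/-- The two constraints expressing `∑ aᵢ xᵢ = c`. -/
def eq {d : ℕ} (a : Fin d → K) (c : K) : List (Constraint K d) := [le a c, le (-a) (-c)]

section

variable {q n k : ℕ} (A : Matrix (Fin k) (Fin n) K) (b : Fin k → K)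
  (V : Fin q → Finset (Fin n → K))

/-- The constraints describing the open face `I`. -/
def faceSystem (I : Finset (Fin k)) : List (Constraint K n) :=
  (List.finRange k).flatMap fun j => if j ∈ I then eq (A j) (b j) else [lt (A j) (b j)]

/-- The index sets of satisfiable faces, by increasing cardinality. -/
def faces : List (Finset (Fin k)) :=
  ((List.range (k + 1)).flatMap fun c =>
    ((List.finRange k).sublistsLen c).map List.toFinset).filter
      fun I => feasible n (faceSystem A b I)

def internal (I : Finset (Fin k)) (r : Fin n → K) : Bool :=
  decide ((∀ j ∈ I, A j ⬝ᵥ r ≤ 0) ∧ ∃ j ∈ I, A j ⬝ᵥ r < 0)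

def unusable (I : Finset (Fin k)) (m : Fin q) : Bool :=
  decide (∃ r ∈ V m, ∃ j ∈ I, 0 < A j ⬝ᵥ r)

def onlyInternal (I : Finset (Fin k)) : Bool :=
  decide (∃ m, ∀ r ∈ V m, internal A I r = true)

/-- For a choice `ρ` of one rate per usable mode: the constraints on weights `t` with
`∑ t m • ρ m = 0`, `∑ t m = 1`, `t ≥ 0`, and `t m = 0` for unusable modes. -/
def weightSystem (I : Finset (Fin k)) (ρ : Fin q → Fin n → K) : List (Constraint K q) :=
  ((List.finRange n).flatMap fun i => eq (fun m => ρ m i) 0) ++ eq (fun _ => 1) 1 ++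
    (List.finRange q).map (fun m => le (-Pi.single m 1) 0) ++
    ((List.finRange q).filter fun m => unusable A V I m).map fun m => le (Pi.single m 1) 0

/-- The choices of one spanning non-internal rate per usable mode (and `0` for the others). -/
def choices (I : Finset (Fin k)) : Finset (Fin q → Fin n → K) :=
  Fintype.piFinset fun m =>
    if unusable A V I m then {0} else (V m).filter fun r => internal A I r = false

/-- Safety of `H_I`: every such choice admits weights. -/
def safeTest (I : Finset (Fin k)) : Bool :=
  decide (∀ ρ ∈ choices A V I, feasible q (weightSystem A V I ρ) = true)

def onFace (x₀ : Fin n → K) (I : Finset (Fin k)) : Bool :=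
  decide (∀ j, (j ∈ I → A j ⬝ᵥ x₀ = b j) ∧ (j ∉ I → A j ⬝ᵥ x₀ < b j))

/-- The program: decides schedulability from the data. -/
def run (x₀ : Fin n → K) : Bool :=
  (markFaces (onlyInternal A V) (fun I => if safeTest A V I then some () else none)
    (faces A b)).answer (onFace A b x₀)

end

end Program

/-- The system whose rate sets are spanned by finite sets of vectors over `K`, seen in `ℝⁿ`. -/
def spannedSystem {K : Type*} [Field K] {q n : ℕ} (φ : K →+* ℝ) (V : Fin q → Finset (Fin n → K)) :
    System (Fin q) n :=
  fun m => convexHull ℝ {y | ∃ r ∈ V m, y = WithLp.toLp 2 fun i => φ (r i)}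

end MultiMode

open MultiMode

/-! On the face `I`, only the signs of the rows in `I` on a rate matter (`isExternal_iff`,
`isInternal_iff`, `mem_restricted_iff`). A positive sign leaves the polytope at once. If all signs
vanish, the motion stays inside the face for a while. Otherwise the state drops to a face with fewer
tight rows. So the system `H_I` describes play inside the face.

Losing faces. If `H_I` is not safe, some choice of vertices of its rate sets has no vanishing convex
combination, and Hahn–Banach gives a functional that grows at speed at least `δ` on all of them. The
environment answers with these rates, and punishes an unusable mode with a rate leaving the
polytope, so that such a mode can only be played for time zero. Since the polytope is bounded, total
time is bounded (`not_schedulable_of_not_isSafeSystem`). Shrinking a winning strategy towards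
another point transfers schedulability from `I` to every `J ⊆ I` (`Schedulable.of_subset`), so
failure passes from `J` up to `I`.

Winning faces. If `H_I` is safe, the zonotope `candidate` is closed: at a vertex where every mode
fails, the failing rates are all summands of that vertex, and their vanishing combination yields a
step that stays inside after all (`IsSafeSystem.isHClosed_candidate`). A closed polytope gives a
uniform step time at all its points (`IsHClosed.exists_uniform`). The scheduler stays in a small
copy of it until the environment picks an internal rate; then the number of tight rows falls, which
happens finitely often. The loop keeps the schedulable faces downward closed, so the next face is
again winning. To need no memory, states are well-ordered and each state uses the least centre whose
local polytope contains it; this index never increases while the face stays the same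
(`IsBMS.exists_positional_strategy`).

Effectiveness. Every test is a linear feasibility question or a sign check on spanning vectors, and
Fourier–Motzkin elimination commutes with an ordered field embedding into `ℝ`. Closedness needs no
test of its own, since it follows from safety. -/

namespace MultiMode

open Filter Topology

/-! ### Faces of a polyhedron -/

section FaceGeometry

variable {M : Type*} {n k : ℕ} {A : Matrix (Fin k) (Fin n) ℝ} {b : Fin k → ℝ} {H : System M n}
  {I J : Finset (Fin k)} {x y r : State n}

/-- The linear functional given by a row of a matrix. -/
noncomputable def row (A : Matrix (Fin k) (Fin n) ℝ) (j : Fin k) : State n →L[ℝ] ℝ :=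
  LinearMap.toContinuousLinearMap
    ((LinearMap.proj j ∘ₗ A.mulVecLin) ∘ₗ (WithLp.linearEquiv 2 ℝ (Fin n → ℝ)).toLinearMap)

theorem mulVec_ofLp (A : Matrix (Fin k) (Fin n) ℝ) (j : Fin k) (x : State n) :
    (A *ᵥ x.ofLp) j = row A j x := rfl

theorem mem_polyhedron : x ∈ polyhedron A b ↔ ∀ j, row A j x ≤ b j := Iff.rfl

theorem onFace_iff :
    OnFace A b I x ↔ ∀ j, (j ∈ I → row A j x = b j) ∧ (j ∉ I → row A j x < b j) := Iff.rfl

theorem polyhedron_eq_iInter (A : Matrix (Fin k) (Fin n) ℝ) (b : Fin k → ℝ) :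
    polyhedron A b = ⋂ j, {x | row A j x ≤ b j} := by
  ext x; simp [mem_polyhedron]

theorem convex_polyhedron (A : Matrix (Fin k) (Fin n) ℝ) (b : Fin k → ℝ) :
    Convex ℝ (polyhedron A b) := by
  rw [polyhedron_eq_iInter]
  exact convex_iInter fun j => convex_halfSpace_le (row A j).toLinearMap.isLinear _

theorem isClosed_polyhedron (A : Matrix (Fin k) (Fin n) ℝ) (b : Fin k → ℝ) :
    IsClosed (polyhedron A b) := by
  rw [polyhedron_eq_iInter]
  exact isClosed_iInter fun j => isClosed_le (row A j).continuous continuous_const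

theorem OnFace.mem (h : OnFace A b I x) : x ∈ polyhedron A b := fun j => by
  by_cases hj : j ∈ I
  · exact ((h j).1 hj).le
  · exact ((h j).2 hj).le

theorem OnFace.mem_iff (h : OnFace A b I x) {j : Fin k} : j ∈ I ↔ row A j x = b j :=
  ⟨(h j).1, fun e => by_contra fun hj => ((h j).2 hj).ne e⟩

theorem OnFace.unique (h : OnFace A b I x) (h' : OnFace A b J x) : I = J := by
  ext j; rw [h.mem_iff, h'.mem_iff]

open scoped Classical in
/-- The indices of the inequalities that are tight at `x`. -/
noncomputable def tight (A : Matrix (Fin k) (Fin n) ℝ) (b : Fin k → ℝ) (x : State n) :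
    Finset (Fin k) :=
  Finset.univ.filter fun j => row A j x = b j

theorem onFace_tight (h : x ∈ polyhedron A b) : OnFace A b (tight A b x) x := by
  rw [onFace_iff]
  intro j
  simp only [tight, Finset.mem_filter, Finset.mem_univ, true_and]
  exact ⟨id, fun hj => lt_of_le_of_ne (h j) hj⟩

theorem OnFace.tight_eq (h : OnFace A b I x) : tight A b x = I :=
  (onFace_tight h.mem).unique h

/-- Uniform times are chosen with this: finitely many smallness requirements are combined as
eventual statements on `𝓝[>] 0`, which avoids minima over possibly empty families. -/
theorem exists_pos_of_eventually {p : ℝ → Prop} (h : ∀ᶠ t in 𝓝[>] (0 : ℝ), p t) :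
    ∃ t, 0 < t ∧ p t := by
  obtain ⟨t, ht, h0⟩ := (h.and self_mem_nhdsWithin).exists
  exact ⟨t, h0, ht⟩

/-- Inequalities that are strict on a compact set stay strict for a uniform time along
bounded rates. -/
theorem exists_uniform_strict {K B : Set (State n)} (hK : IsCompact K)
    (hB : Bornology.IsBounded B) (hKI : ∀ p ∈ K, OnFace A b I p) :
    ∃ T : ℝ, 0 < T ∧ ∀ p ∈ K, ∀ r ∈ B, ∀ s : ℝ, 0 ≤ s → s ≤ T → ∀ j, j ∉ I →
      row A j (p + s • r) < b j := by
  have key : ∀ j, ∀ᶠ T in 𝓝[>] (0 : ℝ), j ∉ I → ∀ p ∈ K, ∀ r ∈ B, ∀ s : ℝ, 0 ≤ s → s ≤ T →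
      row A j (p + s • r) < b j := by
    intro j
    by_cases hj : j ∈ I
    · exact Eventually.of_forall fun _ h => absurd hj h
    rcases K.eq_empty_or_nonempty with rfl | hne
    · simp
    obtain ⟨p₀, hp₀, hmax⟩ := hK.exists_isMaxOn hne (row A j).continuous.continuousOn
    obtain ⟨C, hC0, hC⟩ := hB.exists_pos_norm_le
    have hgap : 0 < b j - row A j p₀ := sub_pos.2 ((hKI p₀ hp₀ j).2 hj)
    -- `D` bounds the growth of row `j` along any rate in `B`; the summand `1` keeps it positive
    -- when the row vanishes. A time below `gap / D` cannot use up the least slack on `K`, attained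
    -- at `p₀`.
    set D := ‖row A j‖ * C + 1
    have hD : 0 < D := by positivity
    filter_upwards [Ioo_mem_nhdsGT (div_pos hgap hD)] with T hT _ p hp r hr s hs hsT
    have h1 : row A j r ≤ D := by
      calc row A j r ≤ ‖row A j r‖ := Real.le_norm_self _
        _ ≤ ‖row A j‖ * ‖r‖ := (row A j).le_opNorm r
        _ ≤ ‖row A j‖ * C := by gcongr; exact hC r hr
        _ ≤ D := by simp [D]
    have h2 : s * row A j r < b j - row A j p₀ := by
      calc s * row A j r ≤ s * D := by gcongr
        _ ≤ T * D := by gcongr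
        _ < b j - row A j p₀ := (lt_div_iff₀ hD).1 hT.2
    have h3 : row A j p ≤ row A j p₀ := hmax hp
    rw [map_add, map_smul, smul_eq_mul]
    linarith
  obtain ⟨T, hT0, hT⟩ := exists_pos_of_eventually (eventually_all.2 key)
  exact ⟨T, hT0, fun p hp r hr s hs hsT j hj => hT j hj p hp r hr s hs hsT⟩

/-- The face reached from the face `I` along the rate `r`. -/
noncomputable def faceAlong (A : Matrix (Fin k) (Fin n) ℝ) (I : Finset (Fin k)) (r : State n) :
    Finset (Fin k) :=
  I.filter fun j => row A j r = 0

theorem faceAlong_subset : faceAlong A I r ⊆ I := Finset.filter_subset _ _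

theorem faceAlong_eq_self : faceAlong A I r = I ↔ ∀ j ∈ I, row A j r = 0 :=
  Finset.filter_eq_self

/-- A tight row stays tight exactly when it vanishes on `r` and becomes strict at once when it is
negative there, so the new face is known as soon as the other rows stay strict. -/
theorem onFace_faceAlong (hx : OnFace A b I x) (hr : ∀ j ∈ I, row A j r ≤ 0) {s : ℝ} (hs : 0 < s)
    (hstrict : ∀ j, j ∉ I → row A j (x + s • r) < b j) :
    OnFace A b (faceAlong A I r) (x + s • r) := by
  rw [onFace_iff]
  intro j
  by_cases hj : j ∈ I
  · have hxj := (hx j).1 hj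
    rw [mulVec_ofLp] at hxj
    simp only [faceAlong, Finset.mem_filter, hj, true_and, map_add, map_smul, smul_eq_mul, hxj]
    refine ⟨fun h => by simp [h], fun h => ?_⟩
    have := mul_neg_of_pos_of_neg hs (lt_of_le_of_ne (hr j hj) h)
    linarith
  · simp only [faceAlong, Finset.mem_filter, hj, false_and, false_imp_iff, not_false_eq_true,
      true_imp_iff, true_and]
    exact hstrict j hj

theorem exists_onFace_faceAlong (hx : OnFace A b I x) (hr : ∀ j ∈ I, row A j r ≤ 0) :
    ∃ δ : ℝ, 0 < δ ∧ ∀ ε : ℝ, 0 < ε → ε ≤ δ → OnFace A b (faceAlong A I r) (x + ε • r) := by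
  obtain ⟨T, hT, h⟩ := exists_uniform_strict (A := A) (b := b) (I := I) (K := {x}) (B := {r})
    isCompact_singleton Bornology.isBounded_singleton (by simpa using hx)
  exact ⟨T, hT, fun ε h0 hε => onFace_faceAlong hx hr h0 (h x rfl r rfl ε h0.le hε)⟩

/-- The criterion no longer mentions a point: an external rate leaves from every point of the face.
The given `x` provides the witness for the reverse direction. -/
theorem isExternal_iff (hx : OnFace A b I x) : IsExternal A b I r ↔ ∃ j ∈ I, 0 < row A j r := by
  constructor
  · rintro ⟨y, hy, h⟩
    by_contra! hr
    obtain ⟨δ, hδ, h'⟩ := exists_onFace_faceAlong hy hr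
    exact h δ hδ (h' δ hδ le_rfl).mem
  · rintro ⟨j, hj, hr⟩
    refine ⟨x, hx, fun δ hδ hmem => ?_⟩
    have h1 : row A j (x + δ • r) ≤ b j := hmem j
    have h2 := hx.mem_iff.1 hj
    rw [map_add, map_smul, smul_eq_mul] at h1
    have := mul_pos hδ hr
    linarith

/-- A point of the face is needed, since on an empty face every rate is vacuously internal. -/
theorem isInternal_iff (hx : OnFace A b I x) :
    IsInternal A b I r ↔ (∀ j ∈ I, row A j r ≤ 0) ∧ ∃ j ∈ I, row A j r < 0 := by
  constructor
  · intro h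
    obtain ⟨δ, hδ, J, hJ, h'⟩ := h x hx
    have h1 := h' δ hδ le_rfl
    have hle : ∀ j ∈ I, row A j r ≤ 0 := by
      intro j hj
      by_contra! hr
      have h2 : row A j (x + δ • r) ≤ b j := h1.mem j
      have h3 := hx.mem_iff.1 hj
      rw [map_add, map_smul, smul_eq_mul] at h2
      have := mul_pos hδ hr
      linarith
    refine ⟨hle, ?_⟩
    by_contra! hge
    obtain ⟨δ', hδ', h2⟩ := exists_onFace_faceAlong hx hle
    -- At the smaller of the two times both descriptions apply to the same point, which would lie on
    -- the face `I` and on the face of the proper subset `J`.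
    have h3 := h2 (min δ δ') (lt_min hδ hδ') (min_le_right _ _)
    rw [faceAlong_eq_self.2 fun j hj => le_antisymm (hle j hj) (hge j hj)] at h3
    exact hJ.ne ((h' (min δ δ') (lt_min hδ hδ') (min_le_left _ _)).unique h3)
  · rintro ⟨hle, j, hj, hlt⟩ y hy
    obtain ⟨δ, hδ, h⟩ := exists_onFace_faceAlong hy hle
    refine ⟨δ, hδ, faceAlong A I r, ?_, h⟩
    refine Finset.ssubset_iff_subset_ne.2 ⟨faceAlong_subset, fun e => ?_⟩
    exact hlt.ne (faceAlong_eq_self.1 e j hj)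

theorem unusable_iff (hx : OnFace A b I x) {m : M} :
    Unusable A b H I m ↔ ∃ r ∈ H m, ∃ j ∈ I, 0 < row A j r := by
  simp only [Unusable, isExternal_iff hx]

theorem not_unusable_iff (hx : OnFace A b I x) {m : M} :
    ¬ Unusable A b H I m ↔ ∀ r ∈ H m, ∀ j ∈ I, row A j r ≤ 0 := by
  rw [unusable_iff hx]; push Not; rfl

theorem OnlyInternal.usable (hx : OnFace A b I x) {m : M} (h : OnlyInternal A b H I m) :
    ¬ Unusable A b H I m :=
  (not_unusable_iff hx).2 fun r hr => ((isInternal_iff hx).1 (h r hr)).1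

/-- For a usable mode the tight rows are nonpositive on all rates, so failing to be internal leaves
only rates tangent to the face. -/
theorem mem_restricted_iff (hx : OnFace A b I x) (m : {m : M // ¬ Unusable A b H I m}) :
    r ∈ restricted A b H I m ↔ r ∈ H m ∧ ∀ j ∈ I, row A j r = 0 := by
  have hm := (not_unusable_iff hx).1 m.2
  simp only [restricted, Set.mem_ofPred_eq, isInternal_iff hx]
  refine and_congr_right fun hr => ?_
  constructor
  · intro h j hj
    by_contra hne
    exact h ⟨hm r hr, j, hj, lt_of_le_of_ne (hm r hr j hj) hne⟩
  · rintro h ⟨-, j, hj, hlt⟩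
    exact hlt.ne (h j hj)

/-- Functionals that are nonpositive on `H m` vanish at an inner point of a segment only if they
vanish at both ends. Hence vertices of the restricted rate set are vertices of `H m`, and there are
finitely many. -/
theorem isExtreme_restricted (hx : OnFace A b I x) (m : {m : M // ¬ Unusable A b H I m}) :
    IsExtreme ℝ (H m) (restricted A b H I m) := by
  have hm := (not_unusable_iff hx).1 m.2
  refine ⟨fun r hr => hr.1, ?_⟩
  intro u hu v hv w hw hwo
  rw [mem_restricted_iff hx] at hw ⊢
  refine ⟨hu, fun j hj => ?_⟩
  obtain ⟨s, t, hs, ht, hst, rfl⟩ := hwo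
  have h := hw.2 j hj
  rw [map_add, map_smul, map_smul, smul_eq_mul, smul_eq_mul] at h
  have h1 := hm u hu j hj
  have h2 := hm v hv j hj
  have h3 : t * row A j v ≤ 0 := mul_nonpos_of_nonneg_of_nonpos ht.le h2
  have h4 : 0 ≤ s * row A j u := by linarith
  have h5 := nonneg_of_mul_nonneg_right h4 hs
  exact le_antisymm h1 h5

theorem convex_restricted (hx : OnFace A b I x) (hH : ∀ m, Convex ℝ (H m))
    (m : {m : M // ¬ Unusable A b H I m}) : Convex ℝ (restricted A b H I m) := by
  have : restricted A b H I m = H m ∩ ⋂ j ∈ I, {r | row A j r = 0} := by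
    ext r; simp [mem_restricted_iff hx]
  rw [this]
  exact (hH m).inter
    (convex_iInter₂ fun j _ => convex_hyperplane (row A j).toLinearMap.isLinear _)

theorem isClosed_restricted (hx : OnFace A b I x) (hH : ∀ m, IsClosed (H m))
    (m : {m : M // ¬ Unusable A b H I m}) : IsClosed (restricted A b H I m) := by
  have : restricted A b H I m = H m ∩ ⋂ j ∈ I, {r | row A j r = 0} := by
    ext r; simp [mem_restricted_iff hx]
  rw [this]
  exact (hH m).inter
    (isClosed_biInter fun j _ => isClosed_eq (row A j).continuous continuous_const)

end FaceGeometry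

/-! ### Fourier–Motzkin elimination -/

namespace Program

/-- Strict or non-strict comparison. -/
def Rel (s : Bool) (u v : ℝ) : Prop := if s then u < v else u ≤ v

theorem Rel.le {s : Bool} {u v : ℝ} (h : Rel s u v) : u ≤ v := by
  cases s <;> simp_all [Rel, le_of_lt]

/-- One-variable case of Fourier–Motzkin: the midpoint of the largest lower and the smallest upper
bound works. A strict bound stays strict there because it is strictly separated from the opposite
extreme bound. -/
theorem exists_rel_rel (lo up : List (ℝ × Bool))
    (h : ∀ l ∈ lo, ∀ u ∈ up, Rel (l.2 || u.2) l.1 u.1) :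
    ∃ t, (∀ l ∈ lo, Rel l.2 l.1 t) ∧ ∀ u ∈ up, Rel u.2 t u.1 := by
  have exmax : lo ≠ [] → ∃ l ∈ lo, ∀ l' ∈ lo, l'.1 ≤ l.1 := fun hne => by
    obtain ⟨l, hl, hmax⟩ := lo.toFinset.exists_max_image Prod.fst
      (by simpa [List.toFinset_nonempty_iff] using hne)
    exact ⟨l, by simpa using hl, fun l' hl' => hmax l' (by simpa using hl')⟩
  have exmin : up ≠ [] → ∃ u ∈ up, ∀ u' ∈ up, u.1 ≤ u'.1 := fun hne => by
    obtain ⟨l, hl, hmin⟩ := up.toFinset.exists_min_image Prod.fst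
      (by simpa [List.toFinset_nonempty_iff] using hne)
    exact ⟨l, by simpa using hl, fun l' hl' => hmin l' (by simpa using hl')⟩
  have rel_of_lt : ∀ {s u v}, u < v → Rel s u v := by
    intro s u v huv; cases s <;> simp [Rel, huv, huv.le]
  rcases eq_or_ne lo [] with rfl | hlo
  · rcases eq_or_ne up [] with rfl | hup
    · exact ⟨0, by simp⟩
    · obtain ⟨u, -, hu⟩ := exmin hup
      exact ⟨u.1 - 1, by simp, fun u' hu' => rel_of_lt (by linarith [hu u' hu'])⟩
  · obtain ⟨l, hl, hmax⟩ := exmax hlo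
    rcases eq_or_ne up [] with rfl | hup
    · exact ⟨l.1 + 1, fun l' hl' => rel_of_lt (by linarith [hmax l' hl']), by simp⟩
    · obtain ⟨u, hu, hmin⟩ := exmin hup
      have hlu := (h l hl u hu).le
      refine ⟨(l.1 + u.1) / 2, fun l' hl' => ?_, fun u' hu' => ?_⟩
      · have h1 := hmax l' hl'
        have h2 := h l' hl' u hu
        cases hs : l'.2
        · simp only [Rel, Bool.false_eq_true, if_false]; linarith
        · simp only [Rel, hs, Bool.true_or, if_true] at h2 ⊢; linarith
      · have h1 := hmin u' hu'
        have h2 := h l hl u' hu'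
        cases hs : u'.2
        · simp only [Rel, Bool.false_eq_true, if_false]; linarith
        · simp only [Rel, hs, Bool.or_true, if_true] at h2 ⊢; linarith

/-- `x` satisfies the constraint `p`. -/
def Sat {d : ℕ} (p : Constraint ℝ d) (x : Fin d → ℝ) : Prop := Rel p.strict (p.a ⬝ᵥ x) p.c

theorem sat_le {d : ℕ} {a x : Fin d → ℝ} {c : ℝ} : Sat (le a c) x ↔ a ⬝ᵥ x ≤ c := by
  simp [Sat, Rel, le]

theorem sat_lt {d : ℕ} {a x : Fin d → ℝ} {c : ℝ} : Sat (lt a c) x ↔ a ⬝ᵥ x < c := by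
  simp [Sat, Rel, lt]

theorem sat_eq {d : ℕ} {a x : Fin d → ℝ} {c : ℝ} :
    (∀ p ∈ eq a c, Sat p x) ↔ a ⬝ᵥ x = c := by
  simp only [eq, List.mem_cons, List.not_mem_nil, or_false, forall_eq_or_imp, forall_eq, sat_le,
    neg_dotProduct, neg_le_neg_iff]
  exact antisymm_iff

theorem sat_cons {d : ℕ} {p : Constraint ℝ (d + 1)} {t : ℝ} {x : Fin d → ℝ} :
    Sat p (Fin.cons t x) ↔ Rel p.strict (p.a 0 * t + (fun i => p.a i.succ) ⬝ᵥ x) p.c := by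
  simp [Sat, dotProduct, Fin.sum_univ_succ]

/-- With `x` fixed, constraints with positive leading coefficient bound `t` above and those with
negative one bound it below. The combined constraints say, after clearing denominators, that each
lower bound is compatible with each upper bound. -/
theorem sat_eliminate {d : ℕ} (C : List (Constraint ℝ (d + 1))) (x : Fin d → ℝ) :
    (∀ p ∈ eliminate C, Sat p x) ↔ ∃ t, ∀ p ∈ C, Sat p (Fin.cons t x) := by
  have hcomb : ∀ p q : Constraint ℝ (d + 1),
      (fun i : Fin d => p.a 0 * q.a i.succ - q.a 0 * p.a i.succ) ⬝ᵥ x =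
        p.a 0 * ((fun i => q.a i.succ) ⬝ᵥ x) - q.a 0 * ((fun i => p.a i.succ) ⬝ᵥ x) := by
    intro p q
    simp only [dotProduct, Finset.mul_sum, ← Finset.sum_sub_distrib]
    exact Finset.sum_congr rfl fun i _ => by ring
  constructor
  · intro h
    have h0 : ∀ p ∈ C, p.a 0 = 0 → Rel p.strict ((fun i => p.a i.succ) ⬝ᵥ x) p.c := by
      intro p hp hp0
      refine h ⟨fun i => p.a i.succ, p.c, p.strict⟩ ?_
      simp only [eliminate, List.mem_append, List.mem_map, List.mem_filter, decide_eq_true_eq]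
      exact Or.inl ⟨p, ⟨hp, hp0⟩, rfl⟩
    have h2 : ∀ p ∈ C, 0 < p.a 0 → ∀ q ∈ C, q.a 0 < 0 → Rel (p.strict || q.strict)
        (p.a 0 * ((fun i => q.a i.succ) ⬝ᵥ x) - q.a 0 * ((fun i => p.a i.succ) ⬝ᵥ x))
        (p.a 0 * q.c - q.a 0 * p.c) := by
      intro p hp hp0 q hq hq0
      rw [← hcomb]
      refine h ⟨_, _, _⟩ ?_
      simp only [eliminate, List.mem_append, List.mem_flatMap, List.mem_map, List.mem_filter,
        decide_eq_true_eq]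
      exact Or.inr ⟨p, ⟨hp, hp0⟩, q, ⟨hq, hq0⟩, rfl⟩
    -- `e p` is the bound that `p` imposes on the eliminated variable, with its strictness.
    set e : Constraint ℝ (d + 1) → ℝ × Bool :=
      fun p => ((p.c - (fun i => p.a i.succ) ⬝ᵥ x) / p.a 0, p.strict) with he
    obtain ⟨t, hlo, hup⟩ := exists_rel_rel ((C.filter fun q => q.a 0 < 0).map e)
      ((C.filter fun p => 0 < p.a 0).map e) (by
        simp only [List.mem_map, List.mem_filter, decide_eq_true_eq, forall_exists_index,
          and_imp]
        rintro _ q hq hq0 rfl _ p hp hp0 rfl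
        have := h2 p hp hp0 q hq hq0
        rw [Bool.or_comm] at this
        simp only [Rel, he] at this ⊢
        split_ifs at this ⊢
        · rw [div_lt_iff_of_neg hq0, mul_comm, ← mul_div_assoc, div_lt_iff₀ hp0]
          linarith
        · rw [div_le_iff_of_neg hq0, mul_comm, ← mul_div_assoc, div_le_iff₀ hp0]
          linarith)
    refine ⟨t, fun p hp => ?_⟩
    rw [sat_cons]
    rcases lt_trichotomy (p.a 0) 0 with hp0 | hp0 | hp0
    · have := hlo (e p) (List.mem_map_of_mem (by simp [hp, hp0]))
      simp only [Rel, he] at this ⊢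
      split_ifs at this ⊢
      · rw [div_lt_iff_of_neg hp0] at this; linarith
      · rw [div_le_iff_of_neg hp0] at this; linarith
    · simpa [hp0] using h0 p hp hp0
    · have := hup (e p) (List.mem_map_of_mem (by simp [hp, hp0]))
      simp only [Rel, he] at this ⊢
      split_ifs at this ⊢
      · rw [lt_div_iff₀ hp0] at this; linarith
      · rw [le_div_iff₀ hp0] at this; linarith
  · rintro ⟨t, h⟩ p hp
    simp only [eliminate, List.mem_append, List.mem_flatMap, List.mem_map, List.mem_filter,
      decide_eq_true_eq] at hp
    rcases hp with ⟨p, ⟨hp, hp0⟩, rfl⟩ | ⟨p, ⟨hp, hp0⟩, q, ⟨hq, hq0⟩, rfl⟩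
    · have := sat_cons.1 (h p hp)
      rwa [hp0, zero_mul, zero_add] at this
    · have h1 := sat_cons.1 (h p hp)
      have h2 := sat_cons.1 (h q hq)
      unfold Sat
      simp only [hcomb]
      have l1 := h1.le
      have l2 := h2.le
      have k1 := mul_le_mul_of_nonneg_left l1 (neg_pos.2 hq0).le
      have k2 := mul_le_mul_of_nonneg_left l2 hp0.le
      cases hsp : p.strict
      · cases hsq : q.strict
        · simp only [Rel, Bool.or_self, Bool.false_eq_true, if_false]; linarith
        · simp only [Rel, hsq, Bool.or_true, if_true] at h2 ⊢
          have := mul_lt_mul_of_pos_left h2 hp0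
          linarith
      · simp only [Rel, hsp, Bool.true_or, if_true] at h1 ⊢
        have := mul_lt_mul_of_pos_left h1 (neg_pos.2 hq0)
        linarith

theorem feasible_iff : ∀ (d : ℕ) (C : List (Constraint ℝ d)),
    feasible d C = true ↔ ∃ x, ∀ p ∈ C, Sat p x
  | 0, C => by
    simp only [feasible, List.all_eq_true, Sat, Rel]
    constructor
    · refine fun h => ⟨0, fun p hp => ?_⟩
      have := h p hp
      split_ifs at this ⊢ <;> simpa using this
    · rintro ⟨x, h⟩ p hp
      have := h p hp
      split_ifs at this ⊢ <;> simpa using this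
  | d + 1, C => by
    rw [feasible, feasible_iff d]
    simp only [sat_eliminate]
    constructor
    · rintro ⟨x, t, h⟩
      exact ⟨_, h⟩
    · rintro ⟨x, h⟩
      exact ⟨Fin.tail x, x 0, by simpa using h⟩

theorem strict_eliminate {d : ℕ} {C : List (Constraint ℝ (d + 1))}
    (h : ∀ p ∈ C, p.strict = false) : ∀ p ∈ eliminate C, p.strict = false := by
  intro p hp
  simp only [eliminate, List.mem_append, List.mem_flatMap, List.mem_map, List.mem_filter,
    decide_eq_true_eq] at hp
  rcases hp with ⟨p, ⟨hp, -⟩, rfl⟩ | ⟨p, ⟨hp, -⟩, q, ⟨hq, -⟩, rfl⟩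
  · exact h p hp
  · simp [h p hp, h q hq]

end Program

/-! ### Polytopes -/

open Program in
/-- A finitely generated cone is polyhedral. -/
theorem exists_constraints_cone {d : ℕ} (s : Finset (Fin d → ℝ)) :
    ∃ C : List (Constraint ℝ d), (∀ p ∈ C, p.strict = false) ∧
      ∀ x, (∀ p ∈ C, Sat p x) ↔ ∃ w : (Fin d → ℝ) → ℝ, (∀ v ∈ s, 0 ≤ w v) ∧
        x = ∑ v ∈ s, w v • v := by
  classical
  induction s using Finset.induction_on with
  | empty =>
    refine ⟨(List.finRange d).flatMap fun i => eq (Pi.single i 1) 0, ?_, fun x => ?_⟩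
    · simp only [List.mem_flatMap, eq, le]; rintro p ⟨i, -, hp⟩; aesop
    · have : (∀ p ∈ (List.finRange d).flatMap fun i => eq (Pi.single i (1 : ℝ)) 0, Sat p x) ↔
          ∀ i, x i = 0 := by
        simp only [List.mem_flatMap, List.mem_finRange, true_and, forall_exists_index]
        rw [forall_comm]
        exact forall_congr' fun i => sat_eq.trans (by simp)
      rw [this]
      simp [funext_iff]
  | insert v s hv ih =>
    obtain ⟨C, hC, h⟩ := ih
    -- A point `x` lies in the enlarged cone iff `x - t • v` lies in the old one for some `t ≥ 0`.
    -- The coefficient `t` becomes variable `0`, which elimination projects away.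
    refine ⟨eliminate (le (Fin.cons (-1) 0) 0 ::
      C.map fun p => ⟨Fin.cons (-(p.a ⬝ᵥ v)) p.a, p.c, p.strict⟩), ?_, fun x => ?_⟩
    · refine strict_eliminate ?_
      simp only [List.mem_cons, List.mem_map]
      rintro p (rfl | ⟨p, hp, rfl⟩)
      · rfl
      · exact hC p hp
    · have key : ∀ t, (∀ p ∈ le (Fin.cons (-1) 0) 0 ::
          C.map fun p => (⟨Fin.cons (-(p.a ⬝ᵥ v)) p.a, p.c, p.strict⟩ : Constraint ℝ (d + 1)),
          Sat p (Fin.cons t x)) ↔ 0 ≤ t ∧ ∀ p ∈ C, Sat p (x - t • v) := by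
        intro t
        simp only [List.mem_cons, List.mem_map, forall_eq_or_imp, forall_exists_index, and_imp,
          forall_apply_eq_imp_iff₂]
        refine and_congr ?_ (forall₂_congr fun p _ => ?_)
        · rw [sat_cons]
          simp [le, Program.Rel]
        · rw [sat_cons]
          simp only [Fin.cons_zero, Fin.cons_succ, Sat, dotProduct_sub, dotProduct_smul,
            smul_eq_mul]
          rw [show -(p.a ⬝ᵥ v) * t + p.a ⬝ᵥ x = p.a ⬝ᵥ x - t * p.a ⬝ᵥ v by ring]
      rw [sat_eliminate]
      simp only [key, h]
      constructor
      · rintro ⟨t, ht, w, hw, hx⟩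
        refine ⟨Function.update w v t, ?_, ?_⟩
        · intro u hu
          rcases eq_or_ne u v with rfl | huv
          · simpa
          · rw [Function.update_of_ne huv]
            exact hw u ((Finset.mem_insert.1 hu).resolve_left huv)
        · rw [Finset.sum_insert hv, Function.update_self, ← sub_eq_iff_eq_add', hx]
          refine Finset.sum_congr rfl fun u hu => ?_
          rw [Function.update_of_ne (by rintro rfl; exact hv hu)]
      · rintro ⟨w, hw, rfl⟩
        refine ⟨w v, hw v (Finset.mem_insert_self _ _), w,
          fun u hu => hw u (Finset.mem_insert_of_mem hu), ?_⟩
        rw [Finset.sum_insert hv, add_sub_cancel_left]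

open Program in
theorem exists_polyhedron_of_constraints {d : ℕ} (C : List (Constraint ℝ d))
    (hC : ∀ p ∈ C, p.strict = false) :
    ∃ (k : ℕ) (A : Matrix (Fin k) (Fin d) ℝ) (b : Fin k → ℝ),
      ∀ x : State d, x ∈ polyhedron A b ↔ ∀ p ∈ C, Sat p x.ofLp := by
  refine ⟨C.length, Matrix.of fun i => (C.get i).a, fun i => (C.get i).c, fun x => ?_⟩
  rw [List.forall_mem_iff_get]
  refine forall_congr' fun i => ?_
  simp [Sat, Program.Rel, hC _ (List.getElem_mem i.2), Matrix.mulVec]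

open Program in
/-- The convex hull of a finite set is a convex polytope. -/
theorem isConvexPolytope_convexHull {n : ℕ} {s : Set (State n)} (hs : s.Finite) :
    IsConvexPolytope (convexHull ℝ s) := by
  classical
  refine ⟨(isBounded_convexHull (s := s)).2 hs.isBounded, ?_⟩
  lift s to Finset (State n) using hs
  -- Homogenization: the hull is the slice at height `1` of the cone over the lifted points.
  -- Substituting `1` for the first coordinate moves `p.a 0` to the right-hand side.
  set e : State n → Fin (n + 1) → ℝ := fun y => Fin.cons 1 y.ofLp with he
  have einj : Function.Injective e := fun y z h => by
    have := congrArg Fin.tail h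
    simp only [he, Fin.tail_cons] at this
    exact WithLp.ofLp_injective 2 this
  obtain ⟨C, hC, h⟩ := exists_constraints_cone (s.image e)
  obtain ⟨k, A, b, hA⟩ := exists_polyhedron_of_constraints
    (C.map fun p => (⟨fun i => p.a i.succ, p.c - p.a 0, p.strict⟩ : Program.Constraint ℝ n))
    (by simpa using hC)
  refine ⟨k, A, b, Set.ext fun x => ?_⟩
  rw [hA]
  have h1 : (∀ p ∈ C.map fun p => (⟨fun i => p.a i.succ, p.c - p.a 0, p.strict⟩ :
      Program.Constraint ℝ n), Sat p x.ofLp) ↔ ∀ p ∈ C, Sat p (e x) := by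
    simp only [List.mem_map, forall_exists_index, and_imp, forall_apply_eq_imp_iff₂]
    refine forall₂_congr fun p hp => ?_
    rw [he, sat_cons]
    simp only [Sat, Program.Rel, hC p hp, mul_one, Bool.false_eq_true, if_false]
    rw [le_sub_iff_add_le']
  rw [h1, h, Finset.mem_convexHull']
  constructor
  · rintro ⟨w, hw, hw1, hwx⟩
    refine ⟨fun v => w (WithLp.toLp 2 (Fin.tail v)), ?_, ?_⟩
    · simp only [Finset.forall_mem_image, he, Fin.tail_cons]
      exact hw
    · rw [Finset.sum_image einj.injOn]
      funext i
      refine Fin.cases ?_ (fun i => ?_) i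
      · simp [he, hw1]
      · rw [← hwx]; simp [he]
  · rintro ⟨w, hw, hx⟩
    rw [Finset.sum_image einj.injOn] at hx
    refine ⟨fun y => w (e y), fun y hy => hw _ (Finset.mem_image_of_mem _ hy), ?_, ?_⟩
    · have := congrFun hx 0
      simpa [he] using this.symm
    · ext i
      have := congrFun hx i.succ
      simpa [he] using this.symm

theorem IsConvexPolytope.convex {n : ℕ} {P : Set (State n)} (h : IsConvexPolytope P) :
    Convex ℝ P := by
  obtain ⟨-, k, A, b, rfl⟩ := h
  exact convex_polyhedron A b

theorem IsConvexPolytope.isCompact {n : ℕ} {P : Set (State n)} (h : IsConvexPolytope P) :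
    IsCompact P := by
  obtain ⟨hb, k, A, b, rfl⟩ := h
  exact Metric.isCompact_of_isClosed_isBounded (isClosed_polyhedron A b) hb

/-- The vertices of a polyhedron are determined by their tight inequalities. -/
theorem finite_extremePoints_polyhedron {n k : ℕ} (A : Matrix (Fin k) (Fin n) ℝ)
    (b : Fin k → ℝ) : ((polyhedron A b).extremePoints ℝ).Finite := by
  refine Set.Finite.of_finite_image (f := tight A b) (Set.toFinite _) ?_
  intro x hx y hy hxy
  have hx' := onFace_tight hx.1
  have hy' := onFace_tight hy.1
  rw [← hxy] at hy'
  set I := tight A b x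
  -- With equal tight rows, `x - y` is tangent to the face, so the segment from `y` to `x` can be
  -- prolonged beyond `x`; extremality of `x` then forces `x = y`.
  have hr : ∀ j ∈ I, row A j (x - y) = 0 := fun j hj => by
    rw [map_sub, hx'.mem_iff.1 hj, hy'.mem_iff.1 hj, sub_self]
  obtain ⟨δ, hδ, h⟩ := exists_onFace_faceAlong hx' fun j hj => (hr j hj).le
  have hz := (h δ hδ le_rfl).mem
  have hmem : x ∈ openSegment ℝ y (x + δ • (x - y)) := by
    have h1 : (0 : ℝ) < 1 + δ := by linarith
    refine ⟨δ / (1 + δ), 1 / (1 + δ), by positivity, by positivity, by field_simp; ring, ?_⟩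
    have : (1 + δ) • (δ / (1 + δ)) • y + (1 + δ) • (1 / (1 + δ)) • (x + δ • (x - y)) =
        (1 + δ) • x := by
      rw [smul_smul, smul_smul, mul_div_cancel₀ _ h1.ne', mul_div_cancel₀ _ h1.ne', one_smul]
      module
    rw [← smul_add] at this
    exact smul_right_injective _ h1.ne' this
  exact (hx.2 hy.1 hz hmem).symm

theorem IsConvexPolytope.finite_extremePoints {n : ℕ} {P : Set (State n)}
    (h : IsConvexPolytope P) : (P.extremePoints ℝ).Finite := by
  obtain ⟨-, k, A, b, rfl⟩ := h
  exact finite_extremePoints_polyhedron A b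

/-- Krein–Milman; the closure is superfluous because the hull of finitely many points is closed. -/
theorem convexHull_extremePoints_eq {n : ℕ} {P : Set (State n)} (hc : IsCompact P)
    (hconv : Convex ℝ P) (hfin : (P.extremePoints ℝ).Finite) :
    convexHull ℝ (P.extremePoints ℝ) = P := by
  simpa only [(hfin.isClosed_convexHull ℝ).closure_eq] using
    closure_convexHull_extremePoints hc hconv

/-! ### Safe systems and closed polytopes -/

section Closed

variable {M : Type*} {n : ℕ} {H : System M n}

/-- A rate set that is spanned by its finitely many vertices keeps a point of a convex set in it
if each of its vertices does for some positive time. -/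
theorem keeps_of_extremePoints {P : Set (State n)} (hP : Convex ℝ P) {c : State n} (hc : c ∈ P)
    {m : M} (hfin : ((H m).extremePoints ℝ).Finite)
    (hhull : convexHull ℝ ((H m).extremePoints ℝ) = H m)
    (h : ∀ r ∈ (H m).extremePoints ℝ, ∃ τ : ℝ, 0 < τ ∧ c + τ • r ∈ P) : Keeps H P c m := by
  choose! τ hτ hmem using h
  obtain ⟨T, hT, hTle⟩ : ∃ T : ℝ, 0 < T ∧ ∀ r ∈ (H m).extremePoints ℝ, T ≤ τ r := by
    refine exists_pos_of_eventually ((hfin.eventually_all).2 fun r hr => ?_)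
    filter_upwards [Ioo_mem_nhdsGT (hτ r hr)] with T hT using hT.2.le
  have seg : ∀ {r : State n} {s t : ℝ}, c + t • r ∈ P → 0 ≤ s → s ≤ t → c + s • r ∈ P := by
    intro r s t ht hs hst
    rcases hs.eq_or_lt with rfl | hs0
    · simpa using hc
    · have ht0 := hs0.trans_le hst
      have := hP.add_smul_mem hc ht (t := s / t) ⟨by positivity, (div_le_one ht0).2 hst⟩
      rwa [smul_smul, div_mul_cancel₀ _ ht0.ne'] at this
  refine ⟨T, hT, fun r hr t ht0 ht => ?_⟩
  refine seg (t := T) ?_ ht0 ht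
  -- At one fixed time the condition on the rate is convex, so it need only be checked at vertices;
  -- shorter times follow along the segment from `c`.
  have hconv : Convex ℝ {r : State n | c + T • r ∈ P} := by
    intro u hu v hv α β hα hβ hαβ
    have : c + T • (α • u + β • v) = α • (c + T • u) + β • (c + T • v) := by
      nth_rewrite 1 [← one_smul ℝ c]; rw [← hαβ]; module
    change c + T • (α • u + β • v) ∈ P
    rw [this]
    exact hP hu hv hα hβ hαβ
  rw [← hhull] at hr
  exact convexHull_min (fun r hr => seg (hmem r hr) hT.le (hTle r hr)) hconv hr

/-- Partial combinations with coefficients in the unit interval lie in the zonotope. -/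
theorem add_smul_sum_mem_convexHull {E : Type*} [AddCommGroup E] [Module ℝ E] {U : Set E}
    (x : E) (c : ℝ) (S : Finset E) (hS : (S : Set E) ⊆ U) (w : E → ℝ)
    (hw : ∀ r ∈ S, 0 ≤ w r ∧ w r ≤ 1) :
    x + c • ∑ r ∈ S, w r • r ∈
      convexHull ℝ {y | ∃ F : Finset E, (F : Set E) ⊆ U ∧ y = x + c • ∑ r ∈ F, r} := by
  classical
  -- Generalized for induction: rates in `F` have coefficient one, those in `S'` a fractional one. A
  -- fractional coefficient is a mixture of leaving the rate out and moving it into `F`.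
  suffices h : ∀ S' : Finset E, S' ⊆ S → ∀ F : Finset E, (F : Set E) ⊆ U → Disjoint F S' →
      x + c • (∑ r ∈ F, r + ∑ r ∈ S', w r • r) ∈
        convexHull ℝ {y | ∃ F : Finset E, (F : Set E) ⊆ U ∧ y = x + c • ∑ r ∈ F, r} by
    simpa using h S subset_rfl ∅ (by simp) (by simp)
  intro S'
  induction S' using Finset.induction_on with
  | empty =>
    intro _ F hF _
    exact subset_convexHull ℝ _ ⟨F, hF, by simp⟩
  | insert v S' hv ih =>
    intro hSS F hF hdisj
    rw [Finset.disjoint_insert_right] at hdisj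
    have hvS : v ∈ S := hSS (Finset.mem_insert_self _ _)
    have h1 := ih ((Finset.subset_insert _ _).trans hSS) F hF hdisj.2
    have h2 := ih ((Finset.subset_insert _ _).trans hSS) (insert v F)
      (by rw [Finset.coe_insert]; exact Set.insert_subset (hS hvS) hF)
      (by rw [Finset.disjoint_insert_left]; exact ⟨hv, hdisj.2⟩)
    rw [Finset.sum_insert hdisj.1] at h2
    have h3 := (convex_convexHull ℝ _) h1 h2 (sub_nonneg.2 (hw v hvS).2) (hw v hvS).1
      (sub_add_cancel _ _)
    convert h3 using 1
    rw [Finset.sum_insert hv]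
    module

theorem candidate_eq (H : System M n) (x : State n) (γ : ℝ) : candidate H x γ =
    convexHull ℝ {y | ∃ F : Finset (State n), (F : Set (State n)) ⊆ ⋃ m, (H m).extremePoints ℝ ∧
      y = x + (γ / ∑ᶠ r ∈ ⋃ m, (H m).extremePoints ℝ, ‖r‖) • ∑ r ∈ F, r} := rfl

theorem finite_candidate_generators [Finite M] (hfin : ∀ m, ((H m).extremePoints ℝ).Finite) (x : State n)
    (c : ℝ) : {y : State n | ∃ F : Finset (State n),
      (F : Set (State n)) ⊆ ⋃ m, (H m).extremePoints ℝ ∧ y = x + c • ∑ r ∈ F, r}.Finite := by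
  classical
  have hU : (⋃ m, (H m).extremePoints ℝ).Finite := Set.finite_iUnion hfin
  refine ((hU.toFinset.powerset.finite_toSet).image
    fun F => x + c • ∑ r ∈ F, r).subset ?_
  rintro y ⟨F, hF, rfl⟩
  exact ⟨F, by simpa [← Finset.coe_subset] using hF, rfl⟩

theorem isConvexPolytope_candidate [Finite M] (hfin : ∀ m, ((H m).extremePoints ℝ).Finite) (x : State n)
    (γ : ℝ) : IsConvexPolytope (candidate H x γ) :=
  isConvexPolytope_convexHull (finite_candidate_generators hfin x _)

theorem mem_candidate (H : System M n) (x : State n) (γ : ℝ) : x ∈ candidate H x γ :=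
  subset_convexHull ℝ _ ⟨∅, by simp, by simp⟩

/-- The candidate polytope of a safe system is closed, around every point. -/
theorem IsSafeSystem.isHClosed_candidate [Fintype M] (hsafe : IsSafeSystem H)
    (hfin : ∀ m, ((H m).extremePoints ℝ).Finite)
    (hhull : ∀ m, convexHull ℝ ((H m).extremePoints ℝ) = H m) (x : State n) {γ : ℝ}
    (hγ : 0 < γ) : IsHClosed H (candidate H x γ) := by
  classical
  refine ⟨isConvexPolytope_candidate hfin x γ, fun v hv => ?_⟩
  by_contra hno
  push Not at hno
  have hbad : ∀ m, ∃ r ∈ (H m).extremePoints ℝ, ∀ τ : ℝ, 0 < τ →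
      v + τ • r ∉ candidate H x γ := by
    intro m
    by_contra! h
    exact hno m (keeps_of_extremePoints (convex_convexHull ℝ _) hv.1 (hfin m) (hhull m) h)
  choose R hR hout using hbad
  obtain ⟨t, ht0, ht1⟩ := hsafe R hR
  obtain ⟨F, hF, rfl⟩ := extremePoints_convexHull_subset hv
  set U := ⋃ m, (H m).extremePoints ℝ with hUdef
  have hU : U.Finite := Set.finite_iUnion hfin
  set N := ∑ᶠ r ∈ U, ‖r‖ with hN
  have hRU : ∀ m, R m ∈ U := fun m => Set.mem_iUnion.2 ⟨m, hR m⟩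
  -- A zero rate never leaves the polytope, so the failing rates are nonzero; this makes the
  -- normalizing sum `N` positive.
  have hRne : ∀ m, R m ≠ 0 := by
    intro m h0
    refine hout m 1 one_pos ?_
    rw [h0, smul_zero, add_zero]
    exact hv.1
  obtain ⟨m₀, hm₀⟩ : ∃ m, t m ≠ 0 := by
    by_contra! h
    simp [h] at ht1
  have hNpos : 0 < N := by
    rw [hN, finsum_mem_eq_finite_toFinset_sum _ hU]
    exact Finset.sum_pos' (fun r _ => norm_nonneg r)
      ⟨R m₀, by simpa using hRU m₀, norm_pos_iff.2 (hRne m₀)⟩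
  have hc : 0 < γ / N := div_pos hγ hNpos
  set c := γ / N with hcdef
  -- If `R m` were missing from `F`, adding it would give the generator `v + c • R m`, so `R m`
  -- would not fail at `v`.
  have hRF : ∀ m, R m ∈ F := by
    intro m
    by_contra hm
    refine hout m c hc ?_
    refine subset_convexHull ℝ _ ⟨insert (R m) F, ?_, ?_⟩
    · rw [Finset.coe_insert]; exact Set.insert_subset (hRU m) hF
    · rw [Finset.sum_insert hm]; module
  -- the total weight of a rate
  set W : State n → ℝ := fun r => ∑ m with R m = r, (t m : ℝ) with hW
  have hW0 : ∀ r, 0 ≤ W r := fun r => Finset.sum_nonneg fun m _ => (t m).2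
  have hW1 : ∀ r, W r ≤ 1 := fun r => by
    have h1 : ∑ m, (t m : ℝ) = 1 := by exact_mod_cast congrArg NNReal.toReal ht1
    rw [← h1]
    exact Finset.sum_le_univ_sum_of_nonneg fun m => (t m).2
  have hWsum : ∑ r ∈ F, W r • r = 0 := by
    have h2 : ∑ m, (t m : ℝ) • R m = 0 := by simpa [NNReal.smul_def] using ht0
    rw [← h2, ← Finset.sum_fiberwise_of_maps_to (s := Finset.univ) (t := F) (g := R)
      (fun m _ => hRF m)]
    refine Finset.sum_congr rfl fun r _ => ?_
    rw [hW, Finset.sum_smul]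
    refine Finset.sum_congr rfl fun m hm => ?_
    rw [(Finset.mem_filter.1 hm).2]
  have hWpos : 0 < W (R m₀) := by
    refine Finset.sum_pos' (fun m _ => (t m).2) ⟨m₀, by simp, ?_⟩
    exact lt_of_le_of_ne (t m₀).2 (fun h => hm₀ (NNReal.coe_injective h.symm))
  -- Since the weighted rates sum to zero, advancing along `R m₀` by its weight equals withdrawing
  -- the weights of all other rates. The resulting coefficients, `1` at `R m₀` and `1 - W r`
  -- elsewhere, lie in the unit interval, so the point stays inside.
  refine hout m₀ (c * W (R m₀)) (mul_pos hc hWpos) ?_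
  have key := add_smul_sum_mem_convexHull x c F hF
    (fun r => if r = R m₀ then 1 else 1 - W r) (by
      intro r _
      split_ifs
      · simp
      · exact ⟨sub_nonneg.2 (hW1 r), sub_le_self _ (hW0 r)⟩)
  rw [candidate_eq]
  convert key using 1
  have h3 : ∀ r ∈ F, (if r = R m₀ then (1 : ℝ) else 1 - W r) • r =
      r - W r • r + (if r = R m₀ then W r • r else 0) := by
    intro r _
    split_ifs <;> module
  rw [Finset.sum_congr rfl h3, Finset.sum_add_distrib, Finset.sum_sub_distrib, hWsum,
    Finset.sum_ite_eq' F (R m₀), if_pos (hRF m₀)]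
  module

/-- Homothetic images of candidates are candidates. -/
theorem candidate_homothety (H : System M n) (x y : State n) {γ γ' : ℝ} (hγ : 0 < γ) :
    candidate H y γ' = (fun p => y + (γ' / γ) • (p - x)) '' candidate H x γ := by
  have hf : (fun p => y + (γ' / γ) • (p - x)) =
      ((γ' / γ) • (AffineMap.id ℝ (State n) - AffineMap.const ℝ (State n) x) +
        AffineMap.const ℝ (State n) y : State n →ᵃ[ℝ] State n) := by
    funext p; simp [add_comm]
  rw [candidate_eq, candidate_eq, hf, AffineMap.image_convexHull, ← hf]
  congr 1
  ext z
  simp only [Set.mem_image, Set.mem_ofPred_eq]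
  constructor
  · rintro ⟨F, hF, rfl⟩
    refine ⟨_, ⟨F, hF, rfl⟩, ?_⟩
    rw [add_sub_cancel_left, smul_smul]
    congr 2
    field_simp
  · rintro ⟨_, ⟨F, hF, rfl⟩, rfl⟩
    refine ⟨F, hF, ?_⟩
    rw [add_sub_cancel_left, smul_smul]
    congr 2
    field_simp

/-- The homothety between candidates carries vertices to vertices and multiplies the kept time by
the ratio of radii. It allows the strategy to use small local polytopes while the algorithm stores
one of arbitrary centre and radius. -/
theorem candidate_extremePoint_keeps {x y : State n} {γ γ' : ℝ} (hγ : 0 < γ) (hγ' : 0 < γ')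
    {c : State n} (hc : c ∈ (candidate H x γ).extremePoints ℝ) {m : M}
    (hk : Keeps H (candidate H x γ) c m) :
    ∃ c' ∈ (candidate H y γ').extremePoints ℝ, Keeps H (candidate H y γ') c' m := by
  have hρ : 0 < γ' / γ := div_pos hγ' hγ
  set ρ := γ' / γ
  have him := candidate_homothety H x y (γ' := γ') hγ
  have hinv : ∀ {u}, y + ρ • (u - x) ∈ candidate H y γ' → u ∈ candidate H x γ := by
    intro u hu
    rw [him] at hu
    obtain ⟨p, hp, hpu⟩ := hu
    have := smul_right_injective _ hρ.ne' (add_left_cancel hpu)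
    rwa [← sub_left_injective this]
  have hto : ∀ {u}, u ∈ candidate H x γ → y + ρ • (u - x) ∈ candidate H y γ' := by
    intro u hu
    rw [him]
    exact ⟨u, hu, rfl⟩
  refine ⟨y + ρ • (c - x), ⟨hto hc.1, ?_⟩, ?_⟩
  · intro u hu v hv huv
    rw [him] at hu hv
    obtain ⟨u, hu, rfl⟩ := hu
    obtain ⟨v, hv, rfl⟩ := hv
    obtain ⟨α, β, hα, hβ, hαβ, h⟩ := huv
    have : c = α • u + β • v := by
      have h1 : α • (y + ρ • (u - x)) + β • (y + ρ • (v - x)) =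
          (α + β) • y + ρ • (α • u + β • v - (α + β) • x) := by module
      dsimp only at h
      rw [h1, hαβ, one_smul, one_smul] at h
      exact (sub_left_injective (smul_right_injective _ hρ.ne' (add_left_cancel h))).symm
    dsimp only
    rw [hc.2 hu hv ⟨α, β, hα, hβ, hαβ, this.symm⟩]
  · obtain ⟨τ, hτ, h⟩ := hk
    refine ⟨ρ * τ, mul_pos hρ hτ, fun r hr t ht0 ht => ?_⟩
    have := hto (h r hr (t / ρ) (by positivity) ((div_le_iff₀' hρ).2 ht))
    convert this using 1
    rw [add_sub_right_comm, smul_add, smul_smul, mul_div_cancel₀ _ hρ.ne', add_assoc]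

/-- From every point of a closed polytope, some mode that keeps a vertex of it keeps the point in
it for a uniform time. -/
theorem IsHClosed.exists_uniform {P : Set (State n)} (hP : IsHClosed H P) :
    ∃ T : ℝ, 0 < T ∧ ∀ p ∈ P, ∃ m, (∃ c ∈ P.extremePoints ℝ, Keeps H P c m) ∧
      ∀ r ∈ H m, ∀ t : ℝ, 0 ≤ t → t ≤ T → p + t • r ∈ P := by
  classical
  obtain ⟨hpoly, hcl⟩ := hP
  have hfin := hpoly.finite_extremePoints
  have hhull := convexHull_extremePoints_eq hpoly.isCompact hpoly.convex hfin
  rcases P.eq_empty_or_nonempty with rfl | hne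
  · exact ⟨1, one_pos, by simp⟩
  obtain ⟨c₀, hc₀⟩ := hpoly.isCompact.extremePoints_nonempty hne
  obtain ⟨m₀, -⟩ := hcl c₀ hc₀
  have : Nonempty M := ⟨m₀⟩
  set E := hfin.toFinset with hE
  have hEc : (E : Set (State n)) = P.extremePoints ℝ := hfin.coe_toFinset
  choose! μ hμ using hcl
  choose! τ hτ hkeep using hμ
  obtain ⟨T, hT, hTle⟩ : ∃ T : ℝ, 0 < T ∧ ∀ c ∈ P.extremePoints ℝ, T ≤ τ c := by
    refine exists_pos_of_eventually ((hfin.eventually_all).2 fun r hr => ?_)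
    filter_upwards [Ioo_mem_nhdsGT (hτ r hr)] with T hT using hT.2.le
  refine ⟨T / (E.card + 1), by positivity, fun p hp => ?_⟩
  have hp' := hp
  rw [← hhull, ← hEc, Finset.mem_convexHull'] at hp'
  obtain ⟨w, hw0, hw1, hwp⟩ := hp'
  -- The weights sum to one, so they cannot all lie below this threshold.
  obtain ⟨c, hcE, hcw⟩ : ∃ c ∈ E, 1 / ((E.card : ℝ) + 1) ≤ w c := by
    by_contra! h
    have h1 : ∑ e ∈ E, w e ≤ ∑ _e ∈ E, 1 / ((E.card : ℝ) + 1) :=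
      Finset.sum_le_sum fun e he => (h e he).le
    rw [hw1, Finset.sum_const, nsmul_eq_mul, mul_one_div, le_div_iff₀ (by positivity)] at h1
    linarith
  have hcP : c ∈ P.extremePoints ℝ := by rw [← hEc]; exact hcE
  refine ⟨μ c, ⟨c, hcP, τ c, hτ c hcP, hkeep c hcP⟩, fun r hr t ht0 ht => ?_⟩
  have hwc : 0 < w c := lt_of_lt_of_le (by positivity) hcw
  have hmem := hkeep c hcP r hr (t / w c) (by positivity) (by
    refine le_trans ?_ (hTle c hcP)
    rw [div_le_iff₀ hwc]
    refine ht.trans ?_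
    rw [← mul_one_div]
    gcongr)
  -- Moving `p` for time `t` amounts to moving only the heavy vertex `c`, for time `t / w c`, which
  -- the choice of the uniform time keeps within `T`.
  have hsplit : p + t • r = ∑ e ∈ E, w e • (if e = c then c + (t / w c) • r else e) := by
    have h3 : ∀ e ∈ E, w e • (if e = c then c + (t / w c) • r else e) =
        w e • e + if e = c then (w e * (t / w c)) • r else 0 := by
      intro e _
      split_ifs with h
      · rw [h]; module
      · simp
    rw [Finset.sum_congr rfl h3, Finset.sum_add_distrib, Finset.sum_ite_eq' E c, if_pos hcE, hwp,
      mul_div_cancel₀ _ hwc.ne']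
  rw [hsplit]
  refine hpoly.convex.sum_mem hw0 hw1 fun e he => ?_
  split_ifs
  · exact hmem
  · exact (hEc ▸ he : e ∈ P.extremePoints ℝ).1

end Closed

/-! ### Plays -/

section Plays

variable {M : Type*} {n : ℕ} {H : System M n} {S : Set (State n)}

theorem history_start (x₀ : State n) (σ : Scheduler M n) (π : Environment H) (i : ℕ) :
    (history x₀ σ π i).start = x₀ := by
  cases i <;> rfl

theorem history_last (x₀ : State n) (σ : Scheduler M n) (π : Environment H) (i : ℕ) :
    (history x₀ σ π i).last = (play x₀ σ π).state i := by
  induction i with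
  | zero => simp [history, FRun.last, Run.state, play]
  | succ i ih =>
    simp only [FRun.last, Run.state, play, history_start] at ih
    simp only [FRun.last, Run.state, play, history, List.map_append, List.sum_append,
      List.map_cons, List.map_nil, List.sum_cons, List.sum_nil, add_zero, Finset.sum_range_succ]
    rw [← add_assoc, ih, ← add_assoc]

theorem Run.state_succ (ρ : Run M n) (i : ℕ) :
    ρ.state (i + 1) = ρ.state i + (ρ.round i).time • (ρ.round i).rate := by
  simp [Run.state, Finset.sum_range_succ, add_assoc]

/-- The positional strategy given by a function of the state. -/
def Scheduler.ofState (f : State n → M × ℝ≥0) : Scheduler M n := fun h => f h.last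

theorem play_ofState_mode (f : State n → M × ℝ≥0) (x₀ : State n) (π : Environment H) (i : ℕ) :
    ((play x₀ (Scheduler.ofState f) π).round i).mode =
      (f ((play x₀ (Scheduler.ofState f) π).state i)).1 := by
  rw [← history_last]; rfl

theorem play_ofState_time (f : State n → M × ℝ≥0) (x₀ : State n) (π : Environment H) (i : ℕ) :
    ((play x₀ (Scheduler.ofState f) π).round i).time =
      (f ((play x₀ (Scheduler.ofState f) π).state i)).2 := by
  rw [← history_last]; rfl

theorem play_rate_mem (σ : Scheduler M n) (x₀ : State n) (π : Environment H) (i : ℕ) :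
    ((play x₀ σ π).round i).rate ∈ H ((play x₀ σ π).round i).mode :=
  π.pick_mem _ _

/-- A function of the state wins if it is safe and the durations depend only on a rank that
never increases. -/
theorem isWinning_ofState {Ω : Type*} [PartialOrder Ω] [WellFoundedLT Ω] {f : State n → M × ℝ≥0}
    {G : Set (State n)} (rank : State n → Ω) (hpos : ∀ y ∈ G, 0 < (f y).2)
    (hsafe : ∀ y ∈ G, ∀ r ∈ H (f y).1, ∀ t ≤ (f y).2, y + t • r ∈ S)
    (hG : ∀ y ∈ G, ∀ r ∈ H (f y).1, y + (f y).2 • r ∈ G)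
    (hrank : ∀ y ∈ G, ∀ r ∈ H (f y).1, rank (y + (f y).2 • r) ≤ rank y)
    (htime : ∀ y ∈ G, ∀ r ∈ H (f y).1, rank (y + (f y).2 • r) = rank y →
      (f (y + (f y).2 • r)).2 = (f y).2) {x₀ : State n} (hx₀ : x₀ ∈ G) :
    IsWinning H S x₀ (Scheduler.ofState f) := by
  intro π
  set ρ := play x₀ (Scheduler.ofState f) π with hρ
  have hmode : ∀ i, (ρ.round i).mode = (f (ρ.state i)).1 := play_ofState_mode f x₀ π
  have htm : ∀ i, (ρ.round i).time = (f (ρ.state i)).2 := play_ofState_time f x₀ π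
  have hrate : ∀ i, (ρ.round i).rate ∈ H (f (ρ.state i)).1 := fun i => by
    rw [← hmode]; exact play_rate_mem _ _ _ _
  have hsucc : ∀ i, ρ.state (i + 1) = ρ.state i + (f (ρ.state i)).2 • (ρ.round i).rate :=
    fun i => by rw [← htm]; exact ρ.state_succ i
  have hmem : ∀ i, ρ.state i ∈ G := by
    intro i
    induction i with
    | zero => simpa [Run.state, hρ, play] using hx₀
    | succ i ih => rw [hsucc]; exact hG _ ih _ (hrate i)
  refine ⟨fun i => ⟨?_, fun t ht => ?_⟩, fun hz => ?_⟩
  · simpa using hsafe _ (hmem i) _ (hrate i) 0 bot_le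
  · exact hsafe _ (hmem i) _ (hrate i) t (by rwa [← htm])
  · have hanti : Antitone fun i => rank (ρ.state i) := antitone_nat_of_succ_le fun i => by
      rw [hsucc]; exact hrank _ (hmem i) _ (hrate i)
    -- Once the rank has stabilized, all durations equal one positive number, so their sum diverges.
    obtain ⟨N, hN⟩ := WellFoundedLT.antitone_chain_condition hanti
    have hconst : ∀ i, (ρ.round (N + i)).time = (ρ.round N).time := by
      intro i
      induction i with
      | zero => rfl
      | succ i ih =>
        rw [← ih, htm, htm, ← add_assoc, hsucc]
        refine htime _ (hmem _) _ (hrate _) ?_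
        rw [← hsucc]
        exact (hN (N + i + 1) (by omega)).symm.trans (hN (N + i) (by omega))
    have hlim := NNReal.tendsto_atTop_zero_of_summable hz
    have hlim' := (tendsto_add_atTop_iff_nat N).2 hlim
    have : (fun i => (ρ.round (i + N)).time) = fun _ => (ρ.round N).time := by
      funext i; rw [add_comm, hconst]
    rw [this] at hlim'
    have h0 := tendsto_nhds_unique tendsto_const_nhds hlim'
    have := hpos _ (hmem N)
    rw [← htm, h0] at this
    exact lt_irrefl _ this

end Plays

/-! ### The strategy on schedulable faces -/

section Strategy

variable {M : Type*} {n k : ℕ} {A : Matrix (Fin k) (Fin n) ℝ} {b : Fin k → ℝ} {H : System M n}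
  {I : Finset (Fin k)}

theorem IsBMS.finite_extremePoints_restricted (hH : IsBMS H) {x : State n} (hx : OnFace A b I x)
    (m : {m : M // ¬ Unusable A b H I m}) :
    ((restricted A b H I m).extremePoints ℝ).Finite :=
  (hH m).2.finite_extremePoints.subset
    (isExtreme_restricted hx m).extremePoints_subset_extremePoints

theorem IsBMS.convexHull_extremePoints_restricted (hH : IsBMS H) {x : State n}
    (hx : OnFace A b I x) (m : {m : M // ¬ Unusable A b H I m}) :
    convexHull ℝ ((restricted A b H I m).extremePoints ℝ) = restricted A b H I m :=
  convexHull_extremePoints_eq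
    ((hH m).2.isCompact.of_isClosed_subset
      (isClosed_restricted hx (fun m => (hH m).2.isCompact.isClosed) m) fun _ h => h.1)
    (convex_restricted hx (fun m => (hH m).2.convex) m)
    (hH.finite_extremePoints_restricted hx m)

/-- A safe restricted system has closed candidates. -/
theorem IsBMS.isHClosed_candidate_restricted [Fintype {m : M // ¬ Unusable A b H I m}]
    (hH : IsBMS H) {x : State n} (hx : OnFace A b I x)
    (hsafe : IsSafeSystem (restricted A b H I)) (z : State n) {γ : ℝ} (hγ : 0 < γ) :
    IsHClosed (restricted A b H I) (candidate (restricted A b H I) z γ) :=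
  hsafe.isHClosed_candidate (hH.finite_extremePoints_restricted hx)
    (hH.convexHull_extremePoints_restricted hx) z hγ

/-- Candidates around a point of a face lie in this face if their radius is small. -/
theorem IsBMS.exists_candidate_onFace [Finite M] (hH : IsBMS H) {x : State n}
    (hx : OnFace A b I x) :
    ∃ γ : ℝ, 0 < γ ∧ ∀ p ∈ candidate (restricted A b H I) x γ, OnFace A b I p := by
  have hpoly := isConvexPolytope_candidate (hH.finite_extremePoints_restricted hx) 0 1
  obtain ⟨T, hT, h⟩ := exists_uniform_strict (I := I) (K := {x}) isCompact_singleton hpoly.1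
    (by simpa using hx)
  have hzero : ∀ j ∈ I, ∀ p ∈ candidate (restricted A b H I) 0 1, row A j p = 0 := by
    intro j hj
    -- The generators around `0` are sums of tangent rates, so the rows in `I` vanish on the whole
    -- polytope; the remaining rows are controlled by the radius `T`.
    refine fun p hp => convexHull_min ?_
      (convex_hyperplane (row A j).toLinearMap.isLinear (0 : ℝ)) hp
    rintro _ ⟨F, hF, rfl⟩
    change row A j _ = 0
    rw [zero_add, map_smul, map_sum, Finset.sum_eq_zero, smul_zero]
    intro r hr
    obtain ⟨m, hm⟩ := Set.mem_iUnion.1 (hF hr)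
    exact ((mem_restricted_iff hx m).1 hm.1).2 j hj
  refine ⟨T, hT, fun p hp => ?_⟩
  rw [candidate_homothety _ 0 x one_pos] at hp
  obtain ⟨q, hq, rfl⟩ := hp
  dsimp only
  rw [div_one, sub_zero]
  rw [onFace_iff]
  refine fun j => ⟨fun hj => ?_, fun hj => h x rfl q hq T hT.le le_rfl j hj⟩
  rw [map_add, map_smul, hzero j hj q hq, smul_zero, add_zero, hx.mem_iff.1 hj]

/-- For the time `T`, mode `m` keeps `p` in the candidate around `z`, unless it leads to a
larger face. -/
def StepOK (A : Matrix (Fin k) (Fin n) ℝ) (b : Fin k → ℝ) (H : System M n) (I : Finset (Fin k))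
    (z : State n) (γ T : ℝ) (p : State n) (m : M) : Prop :=
  (∃ hm : ¬ Unusable A b H I m, ∃ c ∈ (candidate (restricted A b H I) z γ).extremePoints ℝ,
      Keeps (restricted A b H I) (candidate (restricted A b H I) z γ) c ⟨m, hm⟩) ∧
    ∀ r ∈ H m, ∀ t : ℝ, 0 ≤ t → t ≤ T → (∀ j, j ∉ I → row A j (p + t • r) < b j) ∧
      ((∀ j ∈ I, row A j r = 0) → p + t • r ∈ candidate (restricted A b H I) z γ)

/-- Closedness controls tangent rates and compactness keeps the other rows strict for every rate.
Both times are uniform over the polytope, which later rules out Zeno runs. -/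
theorem IsBMS.exists_stepOK [Finite M] [Fintype {m : M // ¬ Unusable A b H I m}] (hH : IsBMS H)
    {x : State n} (hx : OnFace A b I x) (hsafe : IsSafeSystem (restricted A b H I)) :
    ∃ γ T : ℝ, 0 < γ ∧ 0 < T ∧ ∀ p ∈ candidate (restricted A b H I) x γ,
      OnFace A b I p ∧ ∃ m, StepOK A b H I x γ T p m := by
  obtain ⟨γ, hγ, hface⟩ := hH.exists_candidate_onFace hx
  have hcl := hH.isHClosed_candidate_restricted hx hsafe x hγ
  obtain ⟨T₁, hT₁, h₁⟩ := hcl.exists_uniform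
  obtain ⟨T₂, hT₂, h₂⟩ := exists_uniform_strict (I := I) hcl.1.isCompact
    ((Bornology.isBounded_iUnion (s := fun m => H m)).2 fun m => (hH m).2.1) hface
  refine ⟨γ, min T₁ T₂, hγ, lt_min hT₁ hT₂, fun p hp => ⟨hface p hp, ?_⟩⟩
  obtain ⟨m, hk, h⟩ := h₁ p hp
  refine ⟨m, ⟨m.2, hk⟩, fun r hr t ht0 ht => ⟨?_, fun hrI => ?_⟩⟩
  · exact h₂ p hp r (Set.mem_iUnion.2 ⟨m, hr⟩) t ht0 (ht.trans (min_le_right _ _))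
  · exact h r ((mem_restricted_iff hx m).2 ⟨hr, hrI⟩) t ht0 (ht.trans (min_le_left _ _))

open scoped Classical in
/-- On a downward closed family of faces that have an internal mode or a safe restricted system,
one positional strategy wins everywhere. -/
theorem IsBMS.exists_positional_strategy [Fintype M] [Nonempty M] (hH : IsBMS H)
    (G : Set (Finset (Fin k)))
    (hdown : ∀ I ∈ G, ∀ J, J ⊆ I → (∃ x, OnFace A b J x) → J ∈ G)
    (hplay : ∀ I ∈ G, (∃ m, OnlyInternal A b H I m) ∨ IsSafeSystem (restricted A b H I)) :
    ∃ σ : Scheduler M n, σ.IsPositional ∧ (∀ h, 0 < (σ h).2) ∧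
      (∀ I ∈ G, ∀ x₀, OnFace A b I x₀ → IsWinning H (polyhedron A b) x₀ σ) ∧
      ∀ (h : FRun M n) (I : Finset (Fin k)), I ∈ G → OnFace A b I h.last →
        ((∃ m, OnlyInternal A b H I m) → OnlyInternal A b H I (σ h).1) ∧
        ((¬ ∃ m, OnlyInternal A b H I m) → ∀ (x : State n) (γ : ℝ), 0 < γ →
          ∃ hm : ¬ Unusable A b H I (σ h).1,
            ∃ c ∈ (candidate (restricted A b H I) x γ).extremePoints ℝ,
              Keeps (restricted A b H I) (candidate (restricted A b H I) x γ) c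
                ⟨(σ h).1, hm⟩) := by
  -- A well-order on states replaces memory: among all centres whose local polytope contains the
  -- current state, the least one is used.
  obtain ⟨lo, wf⟩ := exists_wellFoundedLT (State n)
  -- the local polytopes
  have hloc : ∀ z, ∃ γ T : ℝ, z ∈ polyhedron A b →
      IsSafeSystem (restricted A b H (tight A b z)) → 0 < γ ∧ 0 < T ∧
        ∀ p ∈ candidate (restricted A b H (tight A b z)) z γ,
          OnFace A b (tight A b z) p ∧ ∃ m, StepOK A b H (tight A b z) z γ T p m := by
    intro z
    by_cases hz : z ∈ polyhedron A b ∧ IsSafeSystem (restricted A b H (tight A b z))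
    · obtain ⟨γ, T, h⟩ := hH.exists_stepOK (onFace_tight hz.1) hz.2
      exact ⟨γ, T, fun _ _ => h⟩
    · exact ⟨0, 0, fun h1 h2 => absurd ⟨h1, h2⟩ hz⟩
  choose γ T hγT using hloc
  set idxSet : State n → Set (State n) := fun y => {z | z ∈ polyhedron A b ∧
    tight A b z = tight A b y ∧ y ∈ candidate (restricted A b H (tight A b z)) z (γ z)}
  have hidx : ∀ y, ∃ z, y ∈ polyhedron A b → z ∈ idxSet y ∧ ∀ z' ∈ idxSet y, z ≤ z' := by
    intro y
    by_cases hy : y ∈ polyhedron A b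
    · have hne : (idxSet y).Nonempty := ⟨y, hy, rfl, mem_candidate _ _ _⟩
      exact ⟨wf.wf.min _ hne, fun _ => ⟨wf.wf.min_mem _ hne,
        fun z' hz' => not_lt.1 (wf.wf.not_lt_min _ hz')⟩⟩
    · exact ⟨0, fun h => absurd h hy⟩
  choose idx hidx using hidx
  have hmove : ∀ y, ∃ a : M × ℝ≥0, 0 < a.2 ∧
      (y ∈ polyhedron A b → tight A b y ∈ G →
        ((∃ m, OnlyInternal A b H (tight A b y) m) → OnlyInternal A b H (tight A b y) a.1 ∧
          ∀ r ∈ H a.1, ∀ t : ℝ, 0 ≤ t → t ≤ a.2 →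
            ∀ j, j ∉ tight A b y → row A j (y + t • r) < b j) ∧
        ((¬ ∃ m, OnlyInternal A b H (tight A b y) m) → (a.2 : ℝ) = T (idx y) ∧
          StepOK A b H (tight A b y) (idx y) (γ (idx y)) (T (idx y)) y a.1)) := by
    intro y
    by_cases hy : y ∈ polyhedron A b ∧ tight A b y ∈ G
    · by_cases hint : ∃ m, OnlyInternal A b H (tight A b y) m
      · obtain ⟨m, hm⟩ := hint
        obtain ⟨T, hT, h⟩ := exists_uniform_strict (I := tight A b y) (K := {y}) (B := H m)
          isCompact_singleton (hH m).2.1 (by simpa using onFace_tight hy.1)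
        exact ⟨⟨m, ⟨T, hT.le⟩⟩, hT, fun _ _ => ⟨fun _ => ⟨hm, h y rfl⟩,
          fun hno => absurd ⟨m, hm⟩ hno⟩⟩
      · obtain ⟨⟨hzS, hzt, hyz⟩, -⟩ := hidx y hy.1
        have hsafe := (hplay _ hy.2).resolve_left hint
        rw [← hzt] at hsafe
        obtain ⟨-, hT, h⟩ := hγT (idx y) hzS hsafe
        obtain ⟨-, m, hm⟩ := h y hyz
        rw [hzt] at hm
        exact ⟨⟨m, ⟨T (idx y), hT.le⟩⟩, hT, fun _ _ => ⟨fun hi => absurd hi hint,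
          fun _ => ⟨rfl, hm⟩⟩⟩
    · exact ⟨⟨Classical.arbitrary M, 1⟩, one_pos, fun h1 h2 => absurd ⟨h1, h2⟩ hy⟩
  choose f hfpos hf using hmove
  -- one step
  have hstrict : ∀ y, y ∈ polyhedron A b → tight A b y ∈ G →
      ¬ Unusable A b H (tight A b y) (f y).1 ∧
      ∀ r ∈ H (f y).1, ∀ t : ℝ, 0 ≤ t → t ≤ (f y).2 →
        ∀ j, j ∉ tight A b y → row A j (y + t • r) < b j := by
    intro y hy hyG
    by_cases hint : ∃ m, OnlyInternal A b H (tight A b y) m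
    · obtain ⟨h1, h2⟩ := (hf y hy hyG).1 hint
      exact ⟨h1.usable (onFace_tight hy), h2⟩
    · obtain ⟨h1, ⟨hm, -⟩, h2⟩ := (hf y hy hyG).2 hint
      refine ⟨hm, fun r hr t ht0 ht => (h2 r hr t ht0 (by rwa [← h1])).1⟩
  have hface : ∀ y, y ∈ polyhedron A b → tight A b y ∈ G → ∀ r ∈ H (f y).1, ∀ t : ℝ, 0 < t →
      t ≤ (f y).2 → OnFace A b (faceAlong A (tight A b y) r) (y + t • r) := by
    intro y hy hyG r hr t ht0 ht
    obtain ⟨hm, h⟩ := hstrict y hy hyG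
    exact onFace_faceAlong (onFace_tight hy) ((not_unusable_iff (onFace_tight hy)).1 hm r hr) ht0
      (h r hr t ht0.le ht)
  have hnext : ∀ y, y ∈ polyhedron A b → tight A b y ∈ G → ∀ r ∈ H (f y).1,
      tight A b (y + (f y).2 • r) = faceAlong A (tight A b y) r := fun y hy hyG r hr =>
    (hface y hy hyG r hr (f y).2 (hfpos y) le_rfl).tight_eq
  -- Either a tight row is lost, or the rate was tangent. In the second case the state stays in the
  -- polytope of the old centre, which therefore still competes for the minimum.
  have hrank : ∀ y, y ∈ polyhedron A b → tight A b y ∈ G → ∀ r ∈ H (f y).1,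
      (tight A b (y + (f y).2 • r)).card < (tight A b y).card ∨
      (tight A b (y + (f y).2 • r) = tight A b y ∧ (¬ ∃ m, OnlyInternal A b H (tight A b y) m) ∧
        idx (y + (f y).2 • r) ≤ idx y) := by
    intro y hy hyG r hr
    have hfa := hface y hy hyG r hr (f y).2 (hfpos y) le_rfl
    have hn := hnext y hy hyG r hr
    by_cases he : faceAlong A (tight A b y) r = tight A b y
    · rw [he] at hn
      have hr0 := faceAlong_eq_self.1 he
      refine Or.inr ⟨hn, ?_⟩
      have hint : ¬ ∃ m, OnlyInternal A b H (tight A b y) m := by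
        intro hint
        have hri := ((hf y hy hyG).1 hint).1 r hr
        obtain ⟨-, j, hj, hlt⟩ := (isInternal_iff (onFace_tight hy)).1 hri
        exact hlt.ne (hr0 j hj)
      refine ⟨hint, ?_⟩
      obtain ⟨h1, -, h2⟩ := (hf y hy hyG).2 hint
      have h3 := (h2 r hr (f y).2 (f y).2.2 h1.le).2 hr0
      obtain ⟨⟨hzS, hzt, hyz⟩, -⟩ := hidx y hy
      refine (hidx _ hfa.mem).2 _ ⟨hzS, ?_, ?_⟩
      · rw [hzt]; exact hn.symm
      · rw [hzt]; exact h3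
    · refine Or.inl ?_
      rw [hn]
      exact Finset.card_lt_card (Finset.ssubset_iff_subset_ne.2 ⟨faceAlong_subset, he⟩)
  refine ⟨Scheduler.ofState f, fun h h' e => congrArg f e, fun h => hfpos _, ?_, ?_⟩
  · intro I hI x₀ hx₀
    refine isWinning_ofState (Ω := ℕ ×ₗ State n)
      (G := {y | y ∈ polyhedron A b ∧ tight A b y ∈ G})
      (fun y => toLex ((tight A b y).card, idx y)) (fun y _ => hfpos y) ?_ ?_ ?_ ?_ ?_
    · rintro y ⟨hy, hyG⟩ r hr t ht
      rcases eq_or_ne t 0 with rfl | ht0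
      · simpa using hy
      · exact (hface y hy hyG r hr t (NNReal.coe_pos.2 (pos_iff_ne_zero.2 ht0)) ht).mem
    · rintro y ⟨hy, hyG⟩ r hr
      have hfa := hface y hy hyG r hr (f y).2 (hfpos y) le_rfl
      refine ⟨hfa.mem, ?_⟩
      rw [hnext y hy hyG r hr]
      exact hdown _ hyG _ faceAlong_subset ⟨_, hfa⟩
    · rintro y ⟨hy, hyG⟩ r hr
      rw [Prod.Lex.toLex_le_toLex]
      rcases hrank y hy hyG r hr with h | ⟨h1, -, h2⟩
      · exact Or.inl h
      · exact Or.inr ⟨congrArg Finset.card h1, h2⟩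
    · rintro y ⟨hy, hyG⟩ r hr he
      rw [EmbeddingLike.apply_eq_iff_eq, Prod.mk.injEq] at he
      rcases hrank y hy hyG r hr with h | ⟨h1, h2, h3⟩
      · exact absurd he.1 h.ne
      · have hfa := hface y hy hyG r hr (f y).2 (hfpos y) le_rfl
        have e1 := ((hf y hy hyG).2 h2).1
        have e2 := ((hf (y + (f y).2 • r) hfa.mem (by rw [h1]; exact hyG)).2 (by rwa [h1])).1
        rw [he.2, ← e1] at e2
        exact NNReal.coe_injective e2
    · exact ⟨hx₀.mem, by rwa [hx₀.tight_eq]⟩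
  · intro h I hI hh
    have hS := hh.mem
    have ht := hh.tight_eq
    have hfh := hf h.last hS (by rwa [ht])
    rw [ht] at hfh
    refine ⟨fun hint => (hfh.1 hint).1, fun hint x γ' hγ' => ?_⟩
    obtain ⟨-, ⟨hm, c, hc, hk⟩, -⟩ := hfh.2 hint
    obtain ⟨⟨hzS, hzt, -⟩, -⟩ := hidx h.last hS
    have hsafe := (hplay _ hI).resolve_left hint
    have hγ := (hγT (idx h.last) hzS (by rwa [hzt, ht])).1
    -- The mode was chosen for a vertex of the local polytope; the homothety moves this vertex to
    -- the prescribed candidate.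
    exact ⟨hm, candidate_extremePoint_keeps hγ hγ' hc hk⟩

end Strategy

/-! ### Unschedulable states -/

section Unschedulable

variable {M : Type*} {n k : ℕ} {A : Matrix (Fin k) (Fin n) ℝ} {b : Fin k → ℝ} {H : System M n}
  {I J : Finset (Fin k)}

/-- Multiply the duration of a round. -/
def Round.rescale (c : ℝ≥0) (s : Round M n) : Round M n := ⟨s.mode, c * s.time, s.rate⟩

/-- Multiply all durations of a finite run and move its start to `x`. -/
def FRun.rescale (x : State n) (c : ℝ≥0) (h : FRun M n) : FRun M n :=
  ⟨x, h.rounds.map (Round.rescale c)⟩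

theorem FRun.rescale_rescale {x y : State n} {c c' : ℝ≥0} (hc : c * c' = 1) {h : FRun M n}
    (hx : h.start = x) : (h.rescale y c').rescale x c = h := by
  obtain ⟨s, l⟩ := h
  cases hx
  simp only [FRun.rescale, List.map_map, FRun.mk.injEq, true_and]
  conv_rhs => rw [← List.map_id l]
  refine List.map_congr_left fun s _ => ?_
  simp [Round.rescale, ← mul_assoc, hc]

/-- A scaled copy of a winning strategy wins from `x'` if the scaled copy of the safety set at
`x'` lies in the safety set. -/
theorem Schedulable.of_homothety {S : Set (State n)} {x x' : State n} {ε : ℝ≥0} (hε : 0 < ε)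
    (hS : ∀ y ∈ S, x' + ε • (y - x) ∈ S) (h : Schedulable H S x) : Schedulable H S x' := by
  obtain ⟨σ, hσ⟩ := h
  have hε1 : ε * ε⁻¹ = 1 := mul_inv_cancel₀ hε.ne'
  have hε2 : ε⁻¹ * ε = 1 := inv_mul_cancel₀ hε.ne'
  refine ⟨fun h => ((σ (h.rescale x ε⁻¹)).1, ε * (σ (h.rescale x ε⁻¹)).2), fun π => ?_⟩
  set σ' : Scheduler M n :=
    fun h => ((σ (h.rescale x ε⁻¹)).1, ε * (σ (h.rescale x ε⁻¹)).2) with hσ'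
  -- The opponent in the original game copies what `π` does in the scaled run, so the two plays are
  -- images of each other.
  set π₀ : Environment H := ⟨fun h a => π.pick (h.rescale x' ε) (a.1, ε * a.2),
    fun _ a => π.pick_mem _ (a.1, ε * a.2)⟩ with hπ₀
  have hnext : ∀ h : FRun M n, h.start = x →
      nextRound σ' π (h.rescale x' ε) = (nextRound σ π₀ h).rescale ε := by
    intro h hx
    simp only [nextRound, Round.rescale, hσ', hπ₀, FRun.rescale_rescale hε2 hx]
  have hhist : ∀ i, history x' σ' π i = (history x σ π₀ i).rescale x' ε := by
    intro i
    induction i with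
    | zero => simp [history, FRun.rescale]
    | succ i ih =>
      simp only [history]
      rw [ih, hnext _ (history_start _ _ _ _)]
      simp [FRun.rescale]
  have hround : ∀ i, (play x' σ' π).round i = ((play x σ π₀).round i).rescale ε := by
    intro i
    simp only [play]
    rw [hhist, hnext _ (history_start _ _ _ _)]
  have hstate : ∀ i, (play x' σ' π).state i = x' + ε • ((play x σ π₀).state i - x) := by
    intro i
    simp only [Run.state, hround]
    simp [play, Round.rescale, Finset.smul_sum, mul_smul]
  obtain ⟨hsafe, hzeno⟩ := hσ π₀
  refine ⟨fun i => ⟨?_, fun t ht => ?_⟩, fun hz => hzeno ?_⟩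
  · rw [hstate]; exact hS _ (hsafe i).1
  · rw [hround] at ht ⊢
    have h1 := (hsafe i).2 (ε⁻¹ * t) (by
      rw [Round.rescale] at ht
      calc ε⁻¹ * t ≤ ε⁻¹ * (ε * ((play x σ π₀).round i).time) := by gcongr
        _ = _ := by rw [← mul_assoc, hε2, one_mul])
    have h2 := hS _ h1
    rw [hstate]
    convert h2 using 1
    simp only [Round.rescale]
    rw [add_sub_right_comm, smul_add, smul_smul, ← mul_assoc, hε1, one_mul, add_assoc]
  · have : (fun i => ((play x' σ' π).round i).time) =
        fun i => ε * ((play x σ π₀).round i).time := by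
      funext i; rw [hround]; rfl
    rw [Run.IsZeno, this] at hz
    simpa only [Run.IsZeno, ← mul_assoc, hε2, one_mul] using hz.mul_left ε⁻¹

/-- Schedulability passes from a face to the larger faces. -/
theorem Schedulable.of_subset (hS : Bornology.IsBounded (polyhedron A b)) {x x' : State n}
    (hx : OnFace A b I x) (hx' : OnFace A b J x') (hJI : J ⊆ I)
    (h : Schedulable H (polyhedron A b) x) : Schedulable H (polyhedron A b) x' := by
  have hB : Bornology.IsBounded ((fun y => y - x) '' polyhedron A b) := by
    obtain ⟨C, hC⟩ := hS.exists_norm_le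
    refine isBounded_iff_forall_norm_le.2 ⟨C + ‖x‖, ?_⟩
    rintro _ ⟨y, hy, rfl⟩
    exact (norm_sub_le _ _).trans (by gcongr; exact hC y hy)
  obtain ⟨T, hT, hstrict⟩ := exists_uniform_strict (I := J) (K := {x'}) isCompact_singleton hB
    (by simpa using hx')
  -- Rows in `J` are tight at both `x` and `x'`, so the shrunken copy respects them at any scale;
  -- the other rows have slack at `x'`, and the polytope is bounded.
  refine h.of_homothety (ε := ⟨T, hT.le⟩) hT fun y hy j => ?_
  change row A j (x' + T • (y - x)) ≤ b j
  by_cases hj : j ∈ J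
  · rw [map_add, map_smul, map_sub, hx'.mem_iff.1 hj, hx.mem_iff.1 (hJI hj), smul_eq_mul]
    have := mul_nonpos_of_nonneg_of_nonpos hT.le (sub_nonpos.2 (hy j))
    rw [mulVec_ofLp] at this
    linarith
  · exact (hstrict x' rfl _ ⟨y, hy, rfl⟩ T hT.le le_rfl j hj).le

/-- Vectors without a vanishing convex combination lie strictly on one side of a hyperplane
through the origin. -/
theorem exists_separating {ι : Type*} [Fintype ι] (R : ι → State n)
    (h : ¬ ∃ t : ι → ℝ≥0, ∑ i, t i • R i = 0 ∧ ∑ i, t i = 1) :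
    ∃ (v : State n →L[ℝ] ℝ) (δ : ℝ), 0 < δ ∧ ∀ i, δ ≤ v (R i) := by
  classical
  set Λ := Fintype.linearCombination ℝ R
  have hconv : Convex ℝ (Λ '' stdSimplex ℝ ι) := (convex_stdSimplex ℝ ι).linear_image Λ
  have hcl : IsClosed (Λ '' stdSimplex ℝ ι) :=
    ((isCompact_stdSimplex ℝ ι).image Λ.continuous_of_finiteDimensional).isClosed
  have h0 : (0 : State n) ∉ Λ '' stdSimplex ℝ ι := by
    rintro ⟨t, ⟨ht0, ht1⟩, ht⟩
    refine h ⟨fun i => (t i).toNNReal, ?_, NNReal.coe_injective ?_⟩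
    · simpa [Λ, Fintype.linearCombination_apply, NNReal.smul_def,
        Real.coe_toNNReal _ (ht0 _)] using ht
    · simpa [Real.coe_toNNReal _ (ht0 _)] using ht1
  obtain ⟨v, u, hu, hv⟩ := geometric_hahn_banach_point_closed hconv hcl h0
  rw [map_zero] at hu
  refine ⟨v, u, hu, fun i => (hv _ ⟨Pi.single i 1, single_mem_stdSimplex ℝ i, ?_⟩).le⟩
  simp [Λ, Fintype.linearCombination_apply, Pi.single_apply]

/-- If the restricted system of a face is not safe, no state of this face is schedulable. -/
theorem not_schedulable_of_not_isSafeSystem [Fintype {m : M // ¬ Unusable A b H I m}]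
    (hS : Bornology.IsBounded (polyhedron A b))
    (hsafe : ¬ IsSafeSystem (restricted A b H I)) {x : State n} (hx : OnFace A b I x) :
    ¬ Schedulable H (polyhedron A b) x := by
  rintro ⟨σ, hσ⟩
  simp only [IsSafeSystem] at hsafe
  push Not at hsafe
  obtain ⟨R, hR, hno⟩ := hsafe
  obtain ⟨v, δ, hδ, hv⟩ := exists_separating R (by rintro ⟨t, h0, h1⟩; exact hno t h0 h1)
  have hrate : ∀ m, ∃ r ∈ H m, (Unusable A b H I m ∧ ∃ j ∈ I, 0 < row A j r) ∨
      ((∀ j ∈ I, row A j r = 0) ∧ δ ≤ v r) := by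
    intro m
    by_cases hm : Unusable A b H I m
    · obtain ⟨r, hr, hj⟩ := (unusable_iff hx).1 hm
      exact ⟨r, hr, Or.inl ⟨hm, hj⟩⟩
    · have h1 := (mem_restricted_iff hx ⟨m, hm⟩).1 (hR ⟨m, hm⟩).1
      exact ⟨_, h1.1, Or.inr ⟨h1.2, hv _⟩⟩
  choose rate hmem hrate using hrate
  set π : Environment H := ⟨fun _ a => rate a.1, fun _ a => hmem a.1⟩
  obtain ⟨hs, hz⟩ := hσ π
  set ρ := play x σ π with hρ
  have hr : ∀ i, (ρ.round i).rate = rate (ρ.round i).mode := fun i => rfl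
  -- The rows in `I` stay tight forever: an unusable mode is met by a violating rate and so can only
  -- last for time zero, and the other rates are tangent. Meanwhile `v` grows by at least `δ` per
  -- unit of time.
  have key : ∀ i, (∀ j ∈ I, row A j (ρ.state i) = b j) ∧
      v x + δ * ∑ l ∈ Finset.range i, ((ρ.round l).time : ℝ) ≤ v (ρ.state i) := by
    intro i
    induction i with
    | zero =>
      have h0 : ρ.state 0 = x := by simp [Run.state, hρ, play]
      rw [h0]
      exact ⟨fun j hj => hx.mem_iff.1 hj, by simp⟩
    | succ i ih =>
      obtain ⟨ih1, ih2⟩ := ih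
      have hsucc : ρ.state (i + 1) =
          ρ.state i + ((ρ.round i).time : ℝ) • rate (ρ.round i).mode := by
        rw [ρ.state_succ, hr]; rfl
      rw [Finset.sum_range_succ, mul_add]
      rcases hrate (ρ.round i).mode with ⟨-, j, hj, hpos⟩ | ⟨hzero, hge⟩
      · have ht : ((ρ.round i).time : ℝ) = 0 := by
          have h1 : row A j (ρ.state (i + 1)) ≤ b j := (hs (i + 1)).1 j
          rw [hsucc, map_add, map_smul, ih1 j hj, smul_eq_mul] at h1
          by_contra hne
          have := mul_pos (lt_of_le_of_ne (ρ.round i).time.coe_nonneg (Ne.symm hne)) hpos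
          linarith
        rw [hsucc, ht, zero_smul, add_zero, mul_zero, add_zero]
        exact ⟨ih1, ih2⟩
      · rw [hsucc]
        refine ⟨fun j hj => ?_, ?_⟩
        · rw [map_add, map_smul, hzero j hj, smul_zero, add_zero, ih1 j hj]
        · rw [map_add, map_smul, smul_eq_mul]
          have := mul_le_mul_of_nonneg_left hge (ρ.round i).time.coe_nonneg
          linarith
  obtain ⟨C, hC⟩ := hS.exists_norm_le
  refine hz ?_
  have hbound : ∀ i, ∑ l ∈ Finset.range i, ((ρ.round l).time : ℝ) ≤ (‖v‖ * C - v x) / δ := by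
    intro i
    rw [le_div_iff₀' hδ]
    have h1 : v (ρ.state i) ≤ ‖v‖ * C := (Real.le_norm_self _).trans
      ((v.le_opNorm _).trans (by gcongr; exact hC _ (hs i).1))
    linarith [(key i).2]
  exact NNReal.summable_coe.1 (summable_of_sum_range_le (fun l => (ρ.round l).time.2) hbound)

end Unschedulable

/-! ### The loop over the faces -/

section Loop

variable {k : ℕ} {α : Type*} {oi : Finset (Fin k) → Bool} {cl : Finset (Fin k) → Option α}

theorem markFaces_concat (L : List (Finset (Fin k))) (I : Finset (Fin k)) :
    markFaces oi cl (L ++ [I]) = markFace oi cl (markFaces oi cl L) I := by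
  simp [markFaces]

theorem markFace_cases (s : Marks k α) (I : Finset (Fin k)) :
    ((∃ J ∈ s.unsched, J ⊆ I) ∧ markFace oi cl s I = ⟨s.sched, I :: s.unsched⟩) ∨
    ((∀ J ∈ s.unsched, ¬ J ⊆ I) ∧ oi I = true ∧
      markFace oi cl s I = ⟨(I, none) :: s.sched, s.unsched⟩) ∨
    ((∀ J ∈ s.unsched, ¬ J ⊆ I) ∧ oi I = false ∧ ∃ P, cl I = some P ∧
      markFace oi cl s I = ⟨(I, some P) :: s.sched, s.unsched⟩) ∨
    ((∀ J ∈ s.unsched, ¬ J ⊆ I) ∧ oi I = false ∧ cl I = none ∧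
      markFace oi cl s I = ⟨s.sched, I :: s.unsched⟩) := by
  unfold markFace
  by_cases h : ∃ J ∈ s.unsched, J ⊆ I
  · exact Or.inl ⟨h, if_pos h⟩
  · rw [if_neg h]
    push Not at h
    cases ho : oi I
    · cases hc : cl I with
      | none => exact Or.inr (Or.inr (Or.inr ⟨h, rfl, rfl, by simp⟩))
      | some P => exact Or.inr (Or.inr (Or.inl ⟨h, rfl, P, rfl, by simp⟩))
    · exact Or.inr (Or.inl ⟨h, rfl, by simp⟩)

/-- The order of the list matters in the last clause: a face marked unschedulable later is never
contained in one treated earlier. This yields downward closure of the schedulable faces. -/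
theorem mem_sched_markFaces {L : List (Finset (Fin k))} (hL : L.Pairwise fun I J => ¬ J ⊆ I) :
    ∀ p ∈ (markFaces oi cl L).sched, p.1 ∈ L ∧
      (p.2 = none → oi p.1 = true) ∧ (∀ P, p.2 = some P → oi p.1 = false ∧ cl p.1 = some P) ∧
      ∀ J ∈ (markFaces oi cl L).unsched, ¬ J ⊆ p.1 := by
  induction L using List.reverseRecOn with
  | nil => simp [markFaces]
  | append_singleton L I ih =>
    obtain ⟨h1, -, h2⟩ := List.pairwise_append.1 hL
    have ih := ih h1
    rw [markFaces_concat]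
    have hmono : ∀ p ∈ (markFaces oi cl L).sched, ¬ I ⊆ p.1 := fun p hp =>
      h2 p.1 (ih p hp).1 I (by simp)
    intro p hp
    rw [List.mem_append]
    rcases markFace_cases (oi := oi) (cl := cl) (markFaces oi cl L) I with
      ⟨-, e⟩ | ⟨hI, ho, e⟩ | ⟨hI, ho, P, hP, e⟩ | ⟨-, -, -, e⟩ <;> rw [e] at hp ⊢
    · obtain ⟨a1, a2, a3, a4⟩ := ih p hp
      refine ⟨Or.inl a1, a2, a3, List.forall_mem_cons.2 ⟨hmono p hp, a4⟩⟩
    · rcases List.mem_cons.1 hp with rfl | hp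
      · exact ⟨Or.inr (by simp), fun _ => ho, by simp, hI⟩
      · obtain ⟨a1, a2, a3, a4⟩ := ih p hp
        exact ⟨Or.inl a1, a2, a3, a4⟩
    · rcases List.mem_cons.1 hp with rfl | hp
      · refine ⟨Or.inr (by simp), by simp, fun Q hQ => ?_, hI⟩
        cases hQ
        exact ⟨ho, hP⟩
      · obtain ⟨a1, a2, a3, a4⟩ := ih p hp
        exact ⟨Or.inl a1, a2, a3, a4⟩
    · obtain ⟨a1, a2, a3, a4⟩ := ih p hp
      refine ⟨Or.inl a1, a2, a3, List.forall_mem_cons.2 ⟨hmono p hp, a4⟩⟩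

theorem mem_unsched_or_sched_markFaces (L : List (Finset (Fin k))) :
    ∀ I ∈ L, I ∈ (markFaces oi cl L).unsched ∨ ∃ o, (I, o) ∈ (markFaces oi cl L).sched := by
  induction L using List.reverseRecOn with
  | nil => simp
  | append_singleton L I ih =>
    rw [markFaces_concat]
    intro J hJ
    rw [List.mem_append, List.mem_singleton] at hJ
    rcases markFace_cases (oi := oi) (cl := cl) (markFaces oi cl L) I with
      ⟨-, e⟩ | ⟨-, -, e⟩ | ⟨-, -, P, -, e⟩ | ⟨-, -, -, e⟩ <;> rw [e] <;>
      rcases hJ with hJ | rfl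
    all_goals first
      | (simp; done)
      | (rcases ih J hJ with h | ⟨o, h⟩
         · exact Or.inl (by simp [h])
         · exact Or.inr ⟨o, by simp [h]⟩)

/-- Induction over the faces marked as unschedulable. -/
theorem unsched_markFaces_induction {Q : Finset (Fin k) → Prop} (L : List (Finset (Fin k)))
    (hsub : ∀ I ∈ L, ∀ J, J ⊆ I → Q J → Q I)
    (hbase : ∀ I ∈ L, oi I = false → cl I = none → Q I) :
    ∀ I ∈ (markFaces oi cl L).unsched, Q I := by
  induction L using List.reverseRecOn with
  | nil => simp [markFaces]
  | append_singleton L I ih =>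
    have ih := ih (fun I hI => hsub I (by simp [hI])) (fun I hI => hbase I (by simp [hI]))
    rw [markFaces_concat]
    rcases markFace_cases (oi := oi) (cl := cl) (markFaces oi cl L) I with
      ⟨⟨J, hJ, hJI⟩, e⟩ | ⟨-, -, e⟩ | ⟨-, -, P, -, e⟩ | ⟨-, ho, hc, e⟩ <;> rw [e]
    · exact List.forall_mem_cons.2 ⟨hsub I (by simp) J hJI (ih J hJ), ih⟩
    · exact ih
    · exact ih
    · exact List.forall_mem_cons.2 ⟨hbase I (by simp) ho hc, ih⟩

/-- The answer depends only on the outcomes of the tests. -/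
theorem answer_markFaces_congr {β : Type*} {oi' : Finset (Fin k) → Bool}
    {cl' : Finset (Fin k) → Option β} {on on' : Finset (Fin k) → Bool}
    (L : List (Finset (Fin k))) (hoi : ∀ I ∈ L, oi I = oi' I)
    (hcl : ∀ I ∈ L, (cl I).isSome = (cl' I).isSome) (hon : ∀ I, on I = on' I) :
    (markFaces oi cl L).answer on = (markFaces oi' cl' L).answer on' := by
  suffices h : (markFaces oi cl L).unsched = (markFaces oi' cl' L).unsched ∧
      (markFaces oi cl L).sched.map Prod.fst = (markFaces oi' cl' L).sched.map Prod.fst by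
    have h1 := congrArg (fun l => l.any on) h.2
    simp only [List.any_map] at h1
    have : on = on' := funext hon
    subst this
    exact h1
  induction L using List.reverseRecOn with
  | nil => simp [markFaces]
  | append_singleton L I ih =>
    obtain ⟨h1, h2⟩ := ih (fun I hI => hoi I (by simp [hI])) (fun I hI => hcl I (by simp [hI]))
    have ho := hoi I (by simp)
    have hc := hcl I (by simp)
    rw [markFaces_concat, markFaces_concat]
    unfold markFace
    rw [h1, ho]
    split_ifs
    · simp [h2]
    · simp [h2]
    · cases e : cl I <;> cases e' : cl' I <;> simp_all

end Loop

/-! ### Admissible orders of the faces -/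

section FaceSequence

variable {n k : ℕ} {A : Matrix (Fin k) (Fin n) ℝ} {b : Fin k → ℝ}

/-- A list of faces by increasing cardinality is compatible with inclusion. -/
theorem pairwise_not_subset_of_card {L : List (Finset (Fin k))} (hnd : L.Nodup)
    (hcard : L.Pairwise fun I J => I.card ≤ J.card) : L.Pairwise fun I J => ¬ J ⊆ I := by
  refine (hcard.and hnd).imp ?_
  rintro I J ⟨hle, hne⟩ hsub
  exact hne (Finset.eq_of_subset_of_card_le hsub hle).symm

theorem exists_isFaceSequence (A : Matrix (Fin k) (Fin n) ℝ) (b : Fin k → ℝ) :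
    ∃ L, IsFaceSequence A b L := by
  classical
  set l := (Finset.univ.filter fun I : Finset (Fin k) => ∃ x, OnFace A b I x).toList
  set L := l.mergeSort fun I J => decide (I.card ≤ J.card) with hL
  have hperm : L.Perm l := List.mergeSort_perm _ _
  have hnd : L.Nodup := hperm.nodup_iff.2 (Finset.nodup_toList _)
  refine ⟨L, hnd, fun I => ?_, pairwise_not_subset_of_card hnd ?_⟩
  · rw [hperm.mem_iff]; simp [l]
  · have := List.pairwise_mergeSort (le := fun I J : Finset (Fin k) => decide (I.card ≤ J.card))
      (by intro a b c h1 h2; simp only [decide_eq_true_eq] at *; omega)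
      (by intro a b; simp only [Bool.or_eq_true, decide_eq_true_eq]; omega) l
    simpa using this

end FaceSequence

/-! ### Correctness of the algorithm -/

section Correctness

variable {M : Type*} [Fintype M] {n k : ℕ} {A : Matrix (Fin k) (Fin n) ℝ} {b : Fin k → ℝ}
  {H : System M n} {x : Finset (Fin k) → State n} {γ : Finset (Fin k) → ℝ}
  {L : List (Finset (Fin k))}

open scoped Classical in
theorem closedFor_eq_some_iff {z : State n} {c : ℝ} {I : Finset (Fin k)} {P : Set (State n)} :
    closedFor A b H z c I = some P ↔ (IsSafeSystem (restricted A b H I) ∧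
      IsHClosed (restricted A b H I) (candidate (restricted A b H I) z c)) ∧
        candidate (restricted A b H I) z c = P := by
  unfold closedFor
  split_ifs with h <;> simp [h]

open scoped Classical in
-- Safety already forces the candidate to be closed for every centre and positive radius, so the
-- arbitrary choices do not influence the outcome.
theorem IsBMS.closedFor_eq_none_iff (hH : IsBMS H) {z : State n} {c : ℝ} (hc : 0 < c)
    {I : Finset (Fin k)} {y : State n} (hy : OnFace A b I y) :
    closedFor A b H z c I = none ↔ ¬ IsSafeSystem (restricted A b H I) := by
  unfold closedFor
  split_ifs with h
  · simp [h.1]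
  · simp only [true_iff]
    exact fun hs => h ⟨hs, hH.isHClosed_candidate_restricted hy hs z hc⟩

/-- The induction only tracks one losing point per face; `Schedulable.of_subset` with equal faces
then spreads the loss to all points. -/
theorem IsBMS.not_schedulable_of_mem_unsched (hH : IsBMS H)
    (hS : Bornology.IsBounded (polyhedron A b)) (hγ : ∀ I, 0 < γ I) (hL : IsFaceSequence A b L)
    {I : Finset (Fin k)} (hI : I ∈ (algorithmMarks A b H x γ L).unsched) {x₀ : State n}
    (hx₀ : OnFace A b I x₀) : ¬ Schedulable H (polyhedron A b) x₀ := by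
  classical
  have key := unsched_markFaces_induction
    (Q := fun I => ∃ y, OnFace A b I y ∧ ¬ Schedulable H (polyhedron A b) y) L
    (fun I hI J hJI ⟨y, hy, hn⟩ => by
      obtain ⟨z, hz⟩ := (hL.2.1 I).1 hI
      exact ⟨z, hz, fun h => hn (h.of_subset hS hz hy hJI)⟩)
    (fun I hI _ hc => by
      obtain ⟨z, hz⟩ := (hL.2.1 I).1 hI
      rw [hH.closedFor_eq_none_iff (hγ I) hz] at hc
      exact ⟨z, hz, not_schedulable_of_not_isSafeSystem hS hc hz⟩) I hI
  obtain ⟨y, hy, hn⟩ := key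
  exact fun h => hn (h.of_subset hS hx₀ hy subset_rfl)

theorem algorithm_eq_true_iff {x₀ : State n} : algorithm A b H x γ L x₀ = true ↔
    ∃ p ∈ (algorithmMarks A b H x γ L).sched, OnFace A b p.1 x₀ := by
  simp [algorithm, Marks.answer]

theorem IsBMS.exists_strategy_of_marks [Nonempty M] (hH : IsBMS H) (hγ : ∀ I, 0 < γ I)
    (hL : IsFaceSequence A b L) :
    ∃ σ : Scheduler M n, σ.IsPositional ∧ (∀ h, 0 < (σ h).2) ∧
      (∀ p ∈ (algorithmMarks A b H x γ L).sched, ∀ x₀, OnFace A b p.1 x₀ →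
        IsWinning H (polyhedron A b) x₀ σ) ∧
      (∀ (h : FRun M n) (I : Finset (Fin k)), OnFace A b I h.last →
        ((I, none) ∈ (algorithmMarks A b H x γ L).sched → OnlyInternal A b H I (σ h).1) ∧
        (∀ P, (I, some P) ∈ (algorithmMarks A b H x γ L).sched →
          ∃ hm : ¬ Unusable A b H I (σ h).1,
            ∃ c ∈ P.extremePoints ℝ, Keeps (restricted A b H I) P c ⟨(σ h).1, hm⟩)) := by
  classical
  have hsch := mem_sched_markFaces (oi := fun I => decide (∃ m, OnlyInternal A b H I m))
    (cl := fun I => closedFor A b H (x I) (γ I) I) hL.2.2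
  have hnone : ∀ I, (I, none) ∈ (algorithmMarks A b H x γ L).sched →
      ∃ m, OnlyInternal A b H I m := fun I hI => by
    simpa using (hsch (I, none) hI).2.1 rfl
  have hsome : ∀ I P, (I, some P) ∈ (algorithmMarks A b H x γ L).sched →
      (¬ ∃ m, OnlyInternal A b H I m) ∧ closedFor A b H (x I) (γ I) I = some P :=
    fun I P hI => by simpa only [decide_eq_false_iff_not] using (hsch (I, some P) hI).2.2.1 P rfl
  obtain ⟨σ, h1, h2, h3, h4⟩ := hH.exists_positional_strategy
    (A := A) (b := b) {I | ∃ o, (I, o) ∈ (algorithmMarks A b H x γ L).sched}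
    (by
      rintro I ⟨o, hI⟩ J hJI hJ
      rcases mem_unsched_or_sched_markFaces L J ((hL.2.1 J).2 hJ) with h | h
      · exact absurd hJI ((hsch _ hI).2.2.2 J h)
      · exact h)
    (by
      rintro I ⟨_ | P, hI⟩
      · exact Or.inl (hnone I hI)
      · exact Or.inr (closedFor_eq_some_iff.1 (hsome I P hI).2).1.1)
  refine ⟨σ, h1, h2, fun p hp => h3 p.1 ⟨p.2, hp⟩, fun h I hI => ⟨fun hm => ?_, fun P hP => ?_⟩⟩
  · exact (h4 h I ⟨none, hm⟩ hI).1 (hnone I hm)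
  · obtain ⟨hno, hcl⟩ := hsome I P hP
    rw [← (closedFor_eq_some_iff.1 hcl).2]
    exact (h4 h I ⟨_, hP⟩ hI).2 hno (x I) (γ I) (hγ I)

/-- The algorithm decides schedulability. -/
theorem IsBMS.algorithm_correct [Nonempty M] (hH : IsBMS H)
    (hS : Bornology.IsBounded (polyhedron A b)) (hγ : ∀ I, 0 < γ I) (hL : IsFaceSequence A b L)
    {x₀ : State n} (hx₀ : x₀ ∈ polyhedron A b) :
    algorithm A b H x γ L x₀ = true ↔ Schedulable H (polyhedron A b) x₀ := by
  rw [algorithm_eq_true_iff]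
  constructor
  · rintro ⟨p, hp, hpx⟩
    obtain ⟨σ, -, -, h, -⟩ := hH.exists_strategy_of_marks hγ hL
    exact ⟨σ, h p hp x₀ hpx⟩
  · intro h
    have hf := onFace_tight hx₀
    rcases mem_unsched_or_sched_markFaces L _ ((hL.2.1 _).2 ⟨x₀, hf⟩) with hu | ⟨o, ho⟩
    · exact absurd h (hH.not_schedulable_of_mem_unsched (x := x) hS hγ hL hu hf)
    · exact ⟨_, ho, hf⟩

end Correctness

/-! ### Correctness of the program -/

section ProgramCorrectness

namespace Program

variable {K : Type*} [Field K] {φ : K →+* ℝ}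

/-- A constraint over `K`, seen over `ℝ`. -/
def Constraint.map {d : ℕ} (φ : K →+* ℝ) (p : Constraint K d) : Constraint ℝ d :=
  ⟨fun i => φ (p.a i), φ p.c, p.strict⟩

theorem sat_map_le {d : ℕ} {a : Fin d → K} {c : K} {x : Fin d → ℝ} :
    Sat ((le a c).map φ) x ↔ (fun i => φ (a i)) ⬝ᵥ x ≤ φ c := sat_le

theorem sat_map_lt {d : ℕ} {a : Fin d → K} {c : K} {x : Fin d → ℝ} :
    Sat ((lt a c).map φ) x ↔ (fun i => φ (a i)) ⬝ᵥ x < φ c := sat_lt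

theorem sat_map_eq {d : ℕ} {a : Fin d → K} {c : K} {x : Fin d → ℝ} :
    (∀ p ∈ eq a c, Sat (p.map φ) x) ↔ (fun i => φ (a i)) ⬝ᵥ x = φ c := by
  have hneg : (fun i => φ ((-a) i)) = -fun i => φ (a i) := by funext i; simp
  simp only [eq, List.mem_cons, List.not_mem_nil, or_false, forall_eq_or_imp, forall_eq,
    sat_map_le, hneg, map_neg, neg_dotProduct, neg_le_neg_iff]
  exact antisymm_iff

variable {q n k : ℕ} {A : Matrix (Fin k) (Fin n) K} {b : Fin k → K}
  {V : Fin q → Finset (Fin n → K)} {I : Finset (Fin k)}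

/-- A vector over `K`, seen in `ℝⁿ`. -/
noncomputable def toState (φ : K →+* ℝ) (r : Fin n → K) : State n :=
  WithLp.toLp 2 fun i => φ (r i)

theorem row_toState (A : Matrix (Fin k) (Fin n) K) (j : Fin k) (r : Fin n → K) :
    row (A.map φ) j (toState φ r) = φ (A j ⬝ᵥ r) :=
  (RingHom.map_dotProduct φ (A j) r).symm

theorem mem_spannedSystem {m : Fin q} {r : Fin n → K} (hr : r ∈ V m) :
    toState φ r ∈ spannedSystem φ V m :=
  subset_convexHull ℝ _ ⟨r, hr, rfl⟩

theorem spannedSystem_subset {m : Fin q} {s : Set (State n)} (hs : Convex ℝ s)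
    (h : ∀ r ∈ V m, toState φ r ∈ s) : spannedSystem φ V m ⊆ s := by
  refine convexHull_min ?_ hs
  rintro _ ⟨r, hr, rfl⟩
  exact h r hr

theorem isBMS_spannedSystem (hV : ∀ m, (V m).Nonempty) : IsBMS (spannedSystem φ V) := by
  intro m
  obtain ⟨r, hr⟩ := hV m
  refine ⟨⟨_, mem_spannedSystem hr⟩, isConvexPolytope_convexHull ?_⟩
  refine ((V m).finite_toSet.image (toState φ)).subset ?_
  rintro _ ⟨r, hr, rfl⟩
  exact ⟨r, hr, rfl⟩

variable [LinearOrder K]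

/-- Elimination uses only ring operations and sign tests, which an ordered embedding preserves;
hence feasibility over `ℝ` can be decided inside `K`. -/
theorem eliminate_map (hφ : StrictMono φ) {d : ℕ} (C : List (Constraint K (d + 1))) :
    eliminate (C.map (Constraint.map φ)) = (eliminate C).map (Constraint.map φ) := by
  have hpos : ∀ a : K, 0 < φ a ↔ 0 < a := fun a => by
    rw [← map_zero φ]; exact hφ.lt_iff_lt
  have hneg : ∀ a : K, φ a < 0 ↔ a < 0 := fun a => by
    rw [← map_zero φ]; exact hφ.lt_iff_lt
  simp only [eliminate, List.filter_map, List.map_append, List.map_map, List.map_flatMap,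
    List.flatMap_map]
  congr 1
  · simp only [Function.comp_def, Constraint.map, map_eq_zero]
  · simp only [Function.comp_def, Constraint.map, hpos, hneg, map_sub, map_mul]

theorem feasible_map (hφ : StrictMono φ) : ∀ (d : ℕ) (C : List (Constraint K d)),
    feasible d (C.map (Constraint.map φ)) = feasible d C
  | 0, C => by
    have hpos : ∀ a : K, 0 < φ a ↔ 0 < a := fun a => by
      rw [← map_zero φ]; exact hφ.lt_iff_lt
    have hnn : ∀ a : K, 0 ≤ φ a ↔ 0 ≤ a := fun a => by
      rw [← map_zero φ]; exact hφ.le_iff_le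
    simp only [feasible, List.all_map, Function.comp_def, Constraint.map, hpos, hnn]
  | d + 1, C => by
    rw [feasible, feasible, eliminate_map hφ, feasible_map hφ d]

theorem feasible_iff_map (hφ : StrictMono φ) {d : ℕ} {C : List (Constraint K d)} :
    feasible d C = true ↔ ∃ x, ∀ p ∈ C, Sat (p.map φ) x := by
  rw [← feasible_map hφ, feasible_iff]
  simp

theorem feasible_faceSystem (hφ : StrictMono φ) :
    feasible n (faceSystem A b I) = true ↔ ∃ x, OnFace (A.map φ) (fun j => φ (b j)) I x := by
  rw [feasible_iff_map hφ]
  have key : ∀ x : Fin n → ℝ, (∀ p ∈ faceSystem A b I, Sat (p.map φ) x) ↔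
      OnFace (A.map φ) (fun j => φ (b j)) I (WithLp.toLp 2 x) := by
    intro x
    simp only [faceSystem, List.mem_flatMap, List.mem_finRange, true_and, forall_exists_index]
    rw [forall_comm]
    refine forall_congr' fun j => ?_
    by_cases hj : j ∈ I
    · simp only [hj, if_true, not_true, false_imp_iff, and_true, true_imp_iff]
      exact sat_map_eq
    · simp only [hj, if_false, not_false_iff, false_imp_iff, true_and, true_imp_iff,
        List.mem_singleton, forall_eq]
      exact sat_map_lt
  simp only [key]
  exact ⟨fun ⟨x, h⟩ => ⟨_, h⟩, fun ⟨x, h⟩ => ⟨x.ofLp, h⟩⟩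

theorem isFaceSequence_faces (hφ : StrictMono φ) :
    IsFaceSequence (A.map φ) (fun j => φ (b j)) (faces A b) := by
  set l : List (Finset (Fin k)) := (List.range (k + 1)).flatMap fun c =>
    ((List.finRange k).sublistsLen c).map List.toFinset with hl
  have hsub : ∀ {c : ℕ} {s : List (Fin k)}, s ∈ (List.finRange k).sublistsLen c →
      s.Nodup ∧ s.Pairwise (· < ·) ∧ s.toFinset.card = c := by
    intro c s hs
    rw [List.mem_sublistsLen] at hs
    have h1 : s.Nodup := hs.1.nodup (List.nodup_finRange k)
    exact ⟨h1, (List.pairwise_lt_finRange k).sublist hs.1,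
      (List.toFinset_card_of_nodup h1).trans hs.2⟩
  have hcard : ∀ {c : ℕ} {J}, J ∈ ((List.finRange k).sublistsLen c).map List.toFinset →
      J.card = c := by
    intro c J hJ
    obtain ⟨s, hs, rfl⟩ := List.mem_map.1 hJ
    exact (hsub hs).2.2
  have hnd : l.Nodup := by
    rw [hl, List.nodup_flatMap]
    refine ⟨fun c _ => ?_, ?_⟩
    · refine List.Nodup.map_on ?_ (List.nodup_sublistsLen _ (List.nodup_finRange k))
      intro s hs t ht hst
      obtain ⟨hs1, hs2, -⟩ := hsub hs
      obtain ⟨ht1, ht2, -⟩ := hsub ht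
      -- Both lists are strictly increasing, so equal underlying sets make them equal.
      have hp : s.Perm t := List.perm_of_nodup_nodup_toFinset_eq hs1 ht1 hst
      exact hp.eq_of_pairwise (fun a b _ _ h1 h2 => absurd h1 (lt_asymm h2)) hs2 ht2
    · refine (List.nodup_range (n := k + 1)).imp ?_
      intro c d hcd J hJ hJ'
      exact hcd ((hcard hJ).symm.trans (hcard hJ'))
  have hpw : l.Pairwise fun I J => I.card ≤ J.card := by
    rw [hl, List.pairwise_flatMap]
    refine ⟨fun c _ => ?_, ?_⟩
    · refine List.pairwise_of_forall_mem_list ?_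
      intro I hI J hJ
      exact ((hcard hI).trans (hcard hJ).symm).le
    · refine (List.pairwise_lt_range (n := k + 1)).imp ?_
      intro c d hcd I hI J hJ
      rw [hcard hI, hcard hJ]
      exact hcd.le
  have hall : ∀ J, J ∈ l := by
    intro J
    rw [hl, List.mem_flatMap]
    have hfilt : ((List.finRange k).filter (· ∈ J)).toFinset = J := by ext; simp
    refine ⟨J.card, List.mem_range.2 ?_, List.mem_map.2
      ⟨(List.finRange k).filter (· ∈ J), List.mem_sublistsLen.2 ⟨List.filter_sublist, ?_⟩, hfilt⟩⟩
    · have := J.card_le_univ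
      rw [Fintype.card_fin] at this
      omega
    · rw [← List.toFinset_card_of_nodup ((List.nodup_finRange k).filter _), hfilt]
  refine ⟨hnd.filter _, fun J => ?_, ?_⟩
  · rw [← feasible_faceSystem hφ]
    simp [faces, ← hl, hall J]
  · exact pairwise_not_subset_of_card (hnd.filter _) (hpw.filter _)

theorem onFace_eq (hφ : StrictMono φ) (x₀ : Fin n → K) : onFace A b x₀ I = true ↔
    OnFace (A.map φ) (fun j => φ (b j)) I (toState φ x₀) := by
  simp only [onFace, decide_eq_true_eq, onFace_iff, row_toState, hφ.injective.eq_iff,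
    hφ.lt_iff_lt]

theorem internal_iff (hφ : StrictMono φ) {b' : Fin k → ℝ} {x : State n}
    (hx : OnFace (A.map φ) b' I x) (r : Fin n → K) :
    internal A I r = true ↔ IsInternal (A.map φ) b' I (toState φ r) := by
  have hneg : ∀ a : K, φ a < 0 ↔ a < 0 := fun a => by
    rw [← map_zero φ]; exact hφ.lt_iff_lt
  have hnp : ∀ a : K, φ a ≤ 0 ↔ a ≤ 0 := fun a => by
    rw [← map_zero φ]; exact hφ.le_iff_le
  rw [isInternal_iff hx]
  simp only [internal, decide_eq_true_eq, row_toState, hneg, hnp]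

theorem unusable_iff (hφ : StrictMono φ) {b' : Fin k → ℝ} {x : State n}
    (hx : OnFace (A.map φ) b' I x) (m : Fin q) :
    unusable A V I m = true ↔ Unusable (A.map φ) b' (spannedSystem φ V) I m := by
  have hpos : ∀ a : K, 0 < φ a ↔ 0 < a := fun a => by
    rw [← map_zero φ]; exact hφ.lt_iff_lt
  rw [MultiMode.unusable_iff hx]
  simp only [unusable, decide_eq_true_eq]
  constructor
  · rintro ⟨r, hr, j, hj, h⟩
    exact ⟨_, mem_spannedSystem hr, j, hj, by rwa [row_toState, hpos]⟩
  · rintro ⟨r, hr, j, hj, h⟩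
    by_contra! hno
    refine absurd h (not_lt.2 ?_)
    refine spannedSystem_subset
      (convex_halfSpace_le (row (A.map φ) j).toLinearMap.isLinear 0) (fun r hr => ?_) hr
    change row (A.map φ) j (toState φ r) ≤ 0
    rw [row_toState, ← not_lt, hpos, not_lt]
    exact hno r hr j hj

/-- Internal rates form a convex set, because a convex combination inherits a strict row from an
endpoint with positive weight. Testing the spanning vectors is therefore enough. -/
theorem onlyInternal_iff (hφ : StrictMono φ) {b' : Fin k → ℝ} {x : State n}
    (hx : OnFace (A.map φ) b' I x) : onlyInternal A V I = true ↔
      ∃ m, OnlyInternal (A.map φ) b' (spannedSystem φ V) I m := by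
  simp only [onlyInternal, decide_eq_true_eq, internal_iff hφ hx]
  refine exists_congr fun m => ⟨fun h => ?_, fun h r hr => h _ (mem_spannedSystem hr)⟩
  have hconv : Convex ℝ {r : State n | IsInternal (A.map φ) b' I r} := by
    simp only [isInternal_iff hx]
    rintro u ⟨hu, ju, hju, hu'⟩ v ⟨hv, jv, hjv, hv'⟩ α β hα hβ hαβ
    refine ⟨fun j hj => ?_, ?_⟩
    · rw [map_add, map_smul, map_smul, smul_eq_mul, smul_eq_mul]
      exact add_nonpos (mul_nonpos_of_nonneg_of_nonpos hα (hu j hj))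
        (mul_nonpos_of_nonneg_of_nonpos hβ (hv j hj))
    · rcases hα.eq_or_lt with rfl | hα
      · obtain rfl : β = 1 := by linarith
        exact ⟨jv, hjv, by simpa using hv'⟩
      · refine ⟨ju, hju, ?_⟩
        rw [map_add, map_smul, map_smul, smul_eq_mul, smul_eq_mul]
        exact add_neg_of_neg_of_nonpos (mul_neg_of_pos_of_neg hα hu')
          (mul_nonpos_of_nonneg_of_nonpos hβ (hv ju hju))
  exact fun r hr => spannedSystem_subset hconv h hr

theorem feasible_weightSystem (hφ : StrictMono φ) (ρ : Fin q → Fin n → K) :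
    feasible q (weightSystem A V I ρ) = true ↔ ∃ t : Fin q → ℝ,
      ∑ m, t m • toState φ (ρ m) = 0 ∧ ∑ m, t m = 1 ∧ (∀ m, 0 ≤ t m) ∧
        ∀ m, unusable A V I m = true → t m ≤ 0 := by
  rw [feasible_iff_map hφ]
  refine exists_congr fun t => ?_
  have hs : ∀ m : Fin q, (fun i => φ ((Pi.single m 1 : Fin q → K) i)) = Pi.single m 1 := by
    intro m; funext i; by_cases h : i = m <;> simp [h]
  have hs' : ∀ m : Fin q, (fun i => -φ ((Pi.single m 1 : Fin q → K) i)) = -Pi.single m 1 := by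
    intro m; rw [← hs m]; rfl
  simp only [weightSystem, List.forall_mem_append, and_assoc]
  refine and_congr ?_ (and_congr ?_ (and_congr ?_ ?_))
  · simp only [List.mem_flatMap, List.mem_finRange, true_and, forall_exists_index]
    rw [forall_comm]
    simp only [sat_map_eq]
    rw [WithLp.ext_iff, funext_iff]
    refine forall_congr' fun i => ?_
    simp [dotProduct, toState, mul_comm]
  · rw [sat_map_eq]
    simp [dotProduct]
  · simp [sat_map_le, hs']
  · simp [sat_map_le, hs]

end Program

/-- In a safe system every choice of rates, extreme or not, admits weights. -/
theorem IsSafeSystem.exists_weights {M : Type*} [Fintype M] {n : ℕ} {H : System M n}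
    (hsafe : IsSafeSystem H) (hhull : ∀ m, convexHull ℝ ((H m).extremePoints ℝ) = H m)
    (R : M → State n) (hR : ∀ m, R m ∈ H m) :
    ∃ t : M → ℝ≥0, ∑ m, t m • R m = 0 ∧ ∑ m, t m = 1 := by
  by_contra hno
  obtain ⟨v, δ, hδ, hv⟩ := exists_separating R hno
  -- A functional positive at a point of each rate set is positive at some vertex of it, and such
  -- vertices contradict safety.
  have hex : ∀ m, ∃ e ∈ (H m).extremePoints ℝ, 0 < v e := by
    intro m
    by_contra! h
    have h1 := hR m
    rw [← hhull m] at h1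
    have h2 : v (R m) ≤ 0 :=
      convexHull_min (s := (H m).extremePoints ℝ) (t := {r | v r ≤ 0}) h
        (convex_halfSpace_le v.toLinearMap.isLinear 0) h1
    linarith [hv m]
  choose E hE hpos using hex
  obtain ⟨t, h0, h1⟩ := hsafe E hE
  obtain ⟨m, hm⟩ : ∃ m, t m ≠ 0 := by
    by_contra! h
    simp [h] at h1
  have h2 := congrArg v h0
  simp only [NNReal.smul_def, map_sum, map_smul, map_zero, smul_eq_mul] at h2
  have h3 : 0 < ∑ m, (t m : ℝ) * v (E m) :=
    Finset.sum_pos' (fun m _ => mul_nonneg (t m).coe_nonneg (hpos m).le)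
      ⟨m, Finset.mem_univ _, mul_pos (NNReal.coe_pos.2 (pos_iff_ne_zero.2 hm)) (hpos m)⟩
  exact h3.ne' h2

theorem sum_subtype_not {ι E : Type*} [Fintype ι] [AddCommMonoid E] (p : ι → Prop)
    [Fintype {i // ¬ p i}] (f : ι → E) (hf : ∀ i, p i → f i = 0) :
    ∑ i : {i // ¬ p i}, f i = ∑ i, f i := by
  classical
  have h := Fintype.sum_subtype_add_sum_subtype p f
  rw [Finset.sum_eq_zero fun (i : {i // p i}) _ => hf i i.2, zero_add] at h
  rw [← h]
  exact Finset.sum_congr (by ext; simp) fun _ _ => rfl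

namespace Program

variable {K : Type*} [Field K] [LinearOrder K] {φ : K →+* ℝ} {q n k : ℕ}
  {A : Matrix (Fin k) (Fin n) K} {b : Fin k → K} {V : Fin q → Finset (Fin n → K)}
  {I : Finset (Fin k)}

/-- The program ranges over spanning vectors, which include all vertices but possibly more. Vertices
of a restricted rate set come from `V m` by `isExtreme_restricted`; the surplus choices are covered
by `IsSafeSystem.exists_weights`. -/
theorem safeTest_iff (hφ : StrictMono φ) {b' : Fin k → ℝ} {x : State n}
    (hx : OnFace (A.map φ) b' I x) (hV : ∀ m, (V m).Nonempty)
    [Fintype {m // ¬ Unusable (A.map φ) b' (spannedSystem φ V) I m}] :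
    safeTest A V I = true ↔ IsSafeSystem (restricted (A.map φ) b' (spannedSystem φ V) I) := by
  classical
  have hBMS : IsBMS (spannedSystem φ V) := isBMS_spannedSystem hV
  simp only [safeTest, decide_eq_true_eq, feasible_weightSystem hφ, choices,
    Fintype.mem_piFinset, unusable_iff hφ hx]
  constructor
  · intro h R hR
    have hgen : ∀ m, ∃ r, r ∈ V m.1 ∧ internal A I r = false ∧ toState φ r = R m := by
      intro m
      have h1 := (isExtreme_restricted hx m).extremePoints_subset_extremePoints (hR m)
      obtain ⟨r, hr, e⟩ := extremePoints_convexHull_subset h1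
      refine ⟨r, hr, ?_, e.symm⟩
      rw [Bool.eq_false_iff, ne_eq, internal_iff hφ hx]
      have h2 := (hR m).1.2
      rw [e] at h2
      exact h2
    choose r hrV hrI hrR using hgen
    set ρ : Fin q → Fin n → K := fun m => if hm : _ then 0 else r ⟨m, hm⟩ with hρ
    obtain ⟨t, h0, h1, hnn, hun⟩ := h ρ (by
      intro m
      by_cases hm : Unusable (A.map φ) b' (spannedSystem φ V) I m
      · simp [hρ, hm]
      · simpa [hρ, hm, hrI] using hrV ⟨m, hm⟩)
    have ht0 : ∀ m, Unusable (A.map φ) b' (spannedSystem φ V) I m → t m = 0 :=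
      fun m hm => le_antisymm (hun m hm) (hnn m)
    refine ⟨fun m => (t m).toNNReal, ?_, NNReal.coe_injective ?_⟩
    · refine Eq.trans ?_ ((sum_subtype_not _ (fun m => t m • toState φ (ρ m))
        fun m hm => by rw [ht0 m hm, zero_smul]).trans h0)
      refine Finset.sum_congr rfl fun m _ => ?_
      simp only [NNReal.smul_def, Real.coe_toNNReal _ (hnn _), hρ, dif_neg m.2, hrR]
    · rw [NNReal.coe_sum, NNReal.coe_one, ← h1, ← sum_subtype_not _ _ ht0]
      exact Finset.sum_congr rfl fun m _ => Real.coe_toNNReal _ (hnn _)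
  · intro hsafe ρ hρ
    have hR : ∀ m : {m // ¬ Unusable (A.map φ) b' (spannedSystem φ V) I m},
        toState φ (ρ m) ∈ restricted (A.map φ) b' (spannedSystem φ V) I m := by
      intro m
      have h1 := hρ m
      rw [if_neg m.2, Finset.mem_filter, Bool.eq_false_iff, ne_eq, internal_iff hφ hx] at h1
      exact ⟨mem_spannedSystem h1.1, h1.2⟩
    obtain ⟨t, h0, h1⟩ := hsafe.exists_weights
      (hBMS.convexHull_extremePoints_restricted hx) _ hR
    set s : Fin q → ℝ := fun m => if hm : _ then 0 else (t ⟨m, hm⟩ : ℝ) with hs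
    have hs0 : ∀ m, Unusable (A.map φ) b' (spannedSystem φ V) I m → s m = 0 := fun m hm => by
      simp [hs, hm]
    have hst : ∀ m : {m // ¬ Unusable (A.map φ) b' (spannedSystem φ V) I m},
        s m = t m := fun m => by simp [hs, m.2]
    refine ⟨s, ?_, ?_, fun m => ?_, fun m hm => (hs0 m hm).le⟩
    · rw [← h0, ← sum_subtype_not _ _ fun m hm => by rw [hs0 m hm, zero_smul]]
      exact Finset.sum_congr rfl fun m _ => by rw [hst, NNReal.smul_def]
    · rw [← sum_subtype_not _ _ hs0, ← NNReal.coe_one, ← h1, NNReal.coe_sum]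
      exact Finset.sum_congr rfl fun m _ => hst m
    · simp only [hs]
      split_ifs
      exacts [le_rfl, NNReal.coe_nonneg _]

/-- Centre `0` and radius `1` are an arbitrary choice; any centres and positive radii would give the
same test outcomes. -/
theorem run_eq_algorithm (hφ : StrictMono φ) (hV : ∀ m, (V m).Nonempty) (x₀ : Fin n → K) :
    run A b V x₀ = algorithm (A.map φ) (fun j => φ (b j)) (spannedSystem φ V) (fun _ => 0)
      (fun _ => 1) (faces A b) (toState φ x₀) := by
  classical
  have hface := (isFaceSequence_faces (A := A) (b := b) hφ).2.1
  refine answer_markFaces_congr _ (fun I hI => ?_) (fun I hI => ?_) fun I => ?_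
  · obtain ⟨x, hx⟩ := (hface I).1 hI
    rw [Bool.eq_iff_iff]
    rw [onlyInternal_iff hφ hx]
    simp
  · obtain ⟨x, hx⟩ := (hface I).1 hI
    rw [Bool.eq_iff_iff, ← not_iff_not]
    simp only [Bool.not_eq_true, Option.isSome_eq_false_iff, Option.isNone_iff_eq_none]
    rw [(isBMS_spannedSystem hV).closedFor_eq_none_iff one_pos hx, ← safeTest_iff hφ hx hV]
    simp
  · rw [Bool.eq_iff_iff]
    exact (onFace_eq hφ x₀).trans (@decide_eq_true_iff _ _).symm

/-- The program decides schedulability. -/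
theorem run_correct (hφ : StrictMono φ) (hq : 0 < q) (hV : ∀ m, (V m).Nonempty)
    (hS : Bornology.IsBounded (polyhedron (A.map φ) fun j => φ (b j))) {x₀ : Fin n → K}
    (hx₀ : toState φ x₀ ∈ polyhedron (A.map φ) fun j => φ (b j)) :
    run A b V x₀ = true ↔ Schedulable (spannedSystem φ V)
      (polyhedron (A.map φ) fun j => φ (b j)) (toState φ x₀) := by
  have : Nonempty (Fin q) := ⟨⟨0, hq⟩⟩
  rw [run_eq_algorithm hφ hV]
  exact (isBMS_spannedSystem hV).algorithm_correct hS (fun _ => one_pos)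
    (isFaceSequence_faces hφ) hx₀

end Program

end ProgramCorrectness

end MultiMode

theorem mainTheorem2 :
    -- Correctness over the reals, and the strategy obtained from the schedulable faces.
    (∀ (M : Type*) [Fintype M] [Nonempty M] (n k : ℕ) (H : System M n)
        (A : Matrix (Fin k) (Fin n) ℝ) (b : Fin k → ℝ)
        (x : Finset (Fin k) → State n) (γ : Finset (Fin k) → ℝ),
        IsBMS H → Bornology.IsBounded (polyhedron A b) → (∀ I, 0 < γ I) →
        (∃ L, IsFaceSequence A b L) ∧
        ∀ L, IsFaceSequence A b L →
          (∀ x₀ ∈ polyhedron A b,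
            algorithm A b H x γ L x₀ = true ↔ Schedulable H (polyhedron A b) x₀) ∧
          ∃ σ : Scheduler M n, σ.IsPositional ∧ (∀ h, 0 < (σ h).2) ∧
            (∀ p ∈ (algorithmMarks A b H x γ L).sched, ∀ x₀, OnFace A b p.1 x₀ →
              IsWinning H (polyhedron A b) x₀ σ) ∧
            (∀ (h : FRun M n) (I : Finset (Fin k)), OnFace A b I h.last →
              ((I, none) ∈ (algorithmMarks A b H x γ L).sched →
                OnlyInternal A b H I (σ h).1) ∧
              (∀ P, (I, some P) ∈ (algorithmMarks A b H x γ L).sched →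
                ∃ hm : ¬ Unusable A b H I (σ h).1,
                  ∃ c ∈ P.extremePoints ℝ, Keeps (restricted A b H I) P c ⟨(σ h).1, hm⟩))) ∧
    -- The algorithm as a program with exact arithmetic in an ordered field.
    (∀ (K : Type*) [Field K] [LinearOrder K] (φ : K →+* ℝ), StrictMono φ →
      ∀ (q n k : ℕ) (A : Matrix (Fin k) (Fin n) K) (b : Fin k → K)
        (V : Fin q → Finset (Fin n → K)) (x₀ : Fin n → K),
        0 < q → (∀ m, (V m).Nonempty) →
        Bornology.IsBounded (polyhedron (A.map φ) fun j => φ (b j)) →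
        (WithLp.toLp 2 fun i => φ (x₀ i)) ∈ polyhedron (A.map φ) (fun j => φ (b j)) →
        (Program.run A b V x₀ = true ↔
          Schedulable (spannedSystem φ V) (polyhedron (A.map φ) fun j => φ (b j))
            (WithLp.toLp 2 fun i => φ (x₀ i)))) := by
  refine ⟨?_, ?_⟩
  · intro M _ _ n k H A b x γ hH hS hγ
    exact ⟨exists_isFaceSequence A b, fun L hL =>
      ⟨fun x₀ hx₀ => hH.algorithm_correct hS hγ hL hx₀, hH.exists_strategy_of_marks hγ hL⟩⟩
  · intro K _ _ φ hφ q n k A b V x₀ hq hV hS hx₀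
    exact Program.run_correct hφ hq hV hS hx₀
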